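/- **Theorem 3.1 (topological Hilbert Satz 90 for idèle groups).** All homology has coefficients in $\mathbb{Z}$. Let $M$ be an oriented, connected, closed $3$-manifold, and let $\mathcal{L}\subset M$ be a link with countably many (finitely or infinitely many) pairwise disjoint tame components $K$. Assume that $\mathcal{L}$ is *very admissible*: for every finite cover $g\colon N'\to M$ branched over a finite sublink of $\mathcal{L}$, with $N'$ a connected closed $3$-manifold, $H_1(N')$ is generated by the homology classes of the components of $g^{-1}(\mathcal{L})$. Let $N$ be a connected closed $3$-manifold and let $f\colon N\to M$ be a finite cyclic branched (Galois) cover, branched over a finite sublink $L_0$ of $\mathcal{L}$, with Galois group $G=\mathrm{Gal}(f)=\langle\tau\rangle$, the group of homeomorphisms of $N$ over $M$. Put $\widetilde{\mathcal{L}}:=f^{-1}(\mathcal{L})$. For each component $K$ of $\mathcal{L}$ let $V_K$ be a tubular neighbourhood of $K$ that is disjoint from the components of $L_0$ other than $K$ (the $V_K$ need not be pairwise disjoint), and for each component $J$ of $f^{-1}(K)$ let $V_J$ be the connected component of $f^{-1}(V_K)$ that contains $J$. Let $\mathbb{Z}[\mu_K]\subset H_1(\partial V_K)$ be the subgroup generated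 by the meridian, i.e. the kernel of $H_1(\partial V_K)\to H_1(V_K)$, and similarly for $J$. The idèle group of $(M,\mathcal{L})$ is $$I_{M,\mathcal{L}}=\Bigl\{(a_K)_K\in\prod_{K\subset\mathcal{L}}H_1(\partial V_K)\;\Big|\;a_K\in\mathbb{Z}[\mu_K]\text{ for all but finitely many }K\Bigr\},$$ and $I_{N,\widetilde{\mathcal{L}}}$ is defined in the same way by the $V_J$, $J\subset\widetilde{\mathcal{L}}$. The group $G$ acts on $I_{N,\widetilde{\mathcal{L}}}$ by $(ga)_{gJ}=g_*(a_J)$, and $f$ induces the homomorphism $f_*\colon I_{N,\widetilde{\mathcal{L}}}\to I_{M,\mathcal{L}}$, $(f_*a)_K=\sum_{J\subset f^{-1}(K)}f_*(a_J)$. Then the Tate cohomology group $\widehat{H}^1(G,I_{N,\widetilde{\mathcal{L}}})$ vanishes. Moreover, for every $a\in I_{N,\widetilde{\mathcal{L}}}$ with $f_*(a)=0$ there exists $b\in I_{N,\widetilde{\mathcal{L}}}$ such that $a=(\tau-1)b$. -/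

import Mathlib

open Topology

noncomputable section

/-! ### Singular homology with integer coefficients -/

/-- The first singular homology group `H₁(X; ℤ)`. -/
abbrev H1 (X : Type) [TopologicalSpace X] : AddCommGrpCat.{0} :=
  ((AlgebraicTopology.singularHomologyFunctor AddCommGrpCat.{0} 1).obj
    (AddCommGrpCat.of ℤ)).obj (TopCat.of X)

/-- The map induced on first homology by a continuous map. -/
def H1.map {X Y : Type} [TopologicalSpace X] [TopologicalSpace Y] (f : C(X, Y)) :
    H1 X →+ H1 Y :=
  (((AlgebraicTopology.singularHomologyFunctor AddCommGrpCat.{0} 1).obj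
    (AddCommGrpCat.of ℤ)).map (TopCat.ofHom f)).hom

theorem H1.map_id {X : Type} [TopologicalSpace X] (a : H1 X) :
    H1.map (ContinuousMap.id X) a = a := by
  have h := ((AlgebraicTopology.singularHomologyFunctor AddCommGrpCat.{0} 1).obj
    (AddCommGrpCat.of ℤ)).map_id (TopCat.of X)
  exact congrArg (fun m => m.hom a) h

theorem H1.map_map {X Y Z : Type} [TopologicalSpace X] [TopologicalSpace Y] [TopologicalSpace Z]
    (g : C(Y, Z)) (f : C(X, Y)) (a : H1 X) :
    H1.map g (H1.map f a) = H1.map (g.comp f) a := by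
  have h := ((AlgebraicTopology.singularHomologyFunctor AddCommGrpCat.{0} 1).obj
    (AddCommGrpCat.of ℤ)).map_comp (TopCat.ofHom f) (TopCat.ofHom g)
  exact (congrArg (fun m => m.hom a) h).symm

/-- The map `H₁(A) → H₁(B)` induced by a continuous map `f : X → Y` with `f(A) ⊆ B`. -/
def H1.mapOn {X Y : Type} [TopologicalSpace X] [TopologicalSpace Y] {f : X → Y}
    (hf : Continuous f) {A : Set X} {B : Set Y} (h : Set.MapsTo f A B) : H1 A →+ H1 B :=
  H1.map ⟨h.restrict f A B, hf.restrict h⟩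

/-- The singular chain complex of `X` with integer coefficients. -/
abbrev singChains (X : Type) [TopologicalSpace X] : ChainComplex AddCommGrpCat.{0} ℕ :=
  ((AlgebraicTopology.singularChainComplexFunctor AddCommGrpCat.{0}).obj
    (AddCommGrpCat.of ℤ)).obj (TopCat.of X)

/-- The chain map induced by a continuous map. -/
abbrev singChainsMap {X Y : Type} [TopologicalSpace X] [TopologicalSpace Y] (f : C(X, Y)) :
    Quiver.Hom (singChains X) (singChains Y) :=
  ((AlgebraicTopology.singularChainComplexFunctor AddCommGrpCat.{0}).obj
    (AddCommGrpCat.of ℤ)).map (TopCat.ofHom f)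

/-- The inclusion of a subset, as a continuous map. -/
def subsetIncl {X : Type} [TopologicalSpace X] (A : Set X) : C(A, X) :=
  ⟨Subtype.val, continuous_subtype_val⟩

/-- The relative singular chain complex `C(X) / C(A)`. -/
abbrev relChains (X : Type) [TopologicalSpace X] (A : Set X) : ChainComplex AddCommGrpCat.{0} ℕ :=
  CategoryTheory.Limits.cokernel (singChainsMap (subsetIncl A))

/-- The relative singular homology group `H_n(X, A; ℤ)`. -/
abbrev relHomology (n : ℕ) (X : Type) [TopologicalSpace X] (A : Set X) : AddCommGrpCat.{0} :=
  (relChains X A).homology n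

/-- The map `H_n(X, A) → H_n(X, B)` induced by the identity of `X`, for `A ⊆ B`. -/
def relHomologyMap (n : ℕ) {X : Type} [TopologicalSpace X] {A B : Set X} (h : A ⊆ B) :
    relHomology n X A →+ relHomology n X B :=
  (HomologicalComplex.homologyMap
    (CategoryTheory.Limits.cokernel.map (singChainsMap (subsetIncl A)) (singChainsMap (subsetIncl B))
      (singChainsMap ⟨Set.inclusion h, continuous_inclusion h⟩) (CategoryTheory.CategoryStruct.id (singChains X)) (by
        rw [CategoryTheory.Category.comp_id, ← CategoryTheory.Functor.map_comp]
        rfl)) n).hom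

/-! ### 3-manifolds, knots and links -/

/-- An orientation of a (topological) 3-manifold `M`: a choice, for each point `x`, of a generator
of the infinite cyclic group `H₃(M, M ∖ {x})`, which is locally induced by a class in
`H₃(M, M ∖ U)` for a neighbourhood `U`. -/
structure Orientation3 (M : Type) [TopologicalSpace M] where
  /-- the local orientation at `x` -/
  cls : ∀ x : M, relHomology 3 M {x}ᶜ
  generates : ∀ (x : M) (z : relHomology 3 M {x}ᶜ), ∃ n : ℤ, z = n • cls x
  consistent : ∀ x : M, ∃ U ∈ 𝓝 x, ∃ α : relHomology 3 M Uᶜ, ∀ (y : M) (hy : y ∈ U),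
    relHomologyMap 3 (Set.compl_subset_compl.mpr (Set.singleton_subset_iff.mpr hy)) α = cls y

/-- `V` is a (closed, tame) tubular neighbourhood of `K`: there is an open embedding of `ℂ × S¹`
taking the core `0 × S¹` onto `K` and the solid torus `D² × S¹` onto `V`. -/
def IsTubularNeighborhood {M : Type} [TopologicalSpace M] (V K : Set M) : Prop :=
  ∃ φ : ℂ × Circle → M, IsOpenEmbedding φ ∧
    φ '' ({0} ×ˢ Set.univ) = K ∧ φ '' (Metric.closedBall 0 1 ×ˢ Set.univ) = V

/-- A tame knot in an orientable 3-manifold: a subset that has a tubular neighbourhood. -/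
def IsTameKnot {M : Type} [TopologicalSpace M] (K : Set M) : Prop :=
  ∃ V : Set M, IsTubularNeighborhood V K

/-- A link with countably many (finitely or infinitely many) tame components `K i`. -/
structure IsTameLink {M : Type} [TopologicalSpace M] {ι : Type} (K : ι → Set M) : Prop where
  countable : Countable ι
  disjoint : Pairwise fun i j => Disjoint (K i) (K j)
  tame : ∀ i, IsTameKnot (K i)

/-! ### Branched covers -/

/-- `f : N → M` is a covering branched over (at most) the link `L`: it is a covering over the
complement of `L`, and around each point over `L` it is, in suitable local coordinates in which
`L` is the axis `0 × ℝ`, the map `(z, t) ↦ (z ^ e, t)` of `ℂ × ℝ` for some `e ≥ 1`. -/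
structure IsBranchedCover {M N : Type} [TopologicalSpace M] [TopologicalSpace N]
    (f : N → M) (L : Set M) : Prop where
  continuous : Continuous f
  covering : IsCoveringMapOn f Lᶜ
  local_model : ∀ y : N, f y ∈ L →
    ∃ (φ : OpenPartialHomeomorph N (ℂ × ℝ)) (ψ : OpenPartialHomeomorph M (ℂ × ℝ)) (e : ℕ),
      0 < e ∧ y ∈ φ.source ∧ φ y = 0 ∧ Set.MapsTo f φ.source ψ.source ∧
      (∀ x ∈ φ.source, ψ (f x) = ((φ x).1 ^ e, (φ x).2)) ∧
      (∀ x ∈ ψ.source, x ∈ L ↔ (ψ x).1 = 0)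

/-- The group of automorphisms of `N` over `M`, i.e. of homeomorphisms `g` with `f ∘ g = f`. -/
def deckGroup {M N : Type} [TopologicalSpace N] (f : N → M) : Subgroup (N ≃ₜ N) where
  carrier := {g | ∀ x, f (g x) = f x}
  mul_mem' := fun {g h} hg hh x => (hg (h x)).trans (hh x)
  one_mem' := fun _ => rfl
  inv_mem' := fun {g} hg x => by
    have h := hg (g⁻¹ x)
    have e : g (g⁻¹ x) = x := g.apply_symm_apply x
    rw [e] at h
    exact h.symm

/-- A cover branched over `L` is Galois if its automorphism group acts transitively on the fibres
over the complement of `L`. -/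
def IsGaloisOver {M N : Type} [TopologicalSpace N] (f : N → M) (L : Set M) : Prop :=
  ∀ x y : N, f x = f y → f x ∉ L → ∃ g ∈ deckGroup f, g x = y

/-! ### Components of preimages -/

/-- The index set of the components of the preimage link `f⁻¹(𝓛)`, for `𝓛` with components `K i`:
pairs of an index `i` and a connected component of `f⁻¹(K i)`. -/
abbrev PreimageIndex {M N : Type} [TopologicalSpace N] {ι : Type} (f : N → M) (K : ι → Set M) :
    Type :=
  Σ i, ConnectedComponents (f ⁻¹' K i)

/-- The component of `f⁻¹(K i)` named by an index, as a subset of `N`. -/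
def preimageKnot {M N : Type} [TopologicalSpace N] {ι : Type} (f : N → M) (K : ι → Set M)
    (j : PreimageIndex f K) : Set N :=
  {x | ∃ h : x ∈ f ⁻¹' K j.1, ConnectedComponents.mk (⟨x, h⟩ : f ⁻¹' K j.1) = j.2}

/-- The tubular neighbourhood `V_J` of a component `J` of `f⁻¹(K i)` induced by a tubular
neighbourhood `V i` of `K i`: the connected component of `f⁻¹(V i)` that contains `J`. -/
def preimageNbhd {M N : Type} [TopologicalSpace N] {ι : Type} (f : N → M) (K V : ι → Set M)
    (j : PreimageIndex f K) : Set N :=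
  {y | ∃ x ∈ preimageKnot f K j, y ∈ connectedComponentIn (f ⁻¹' V j.1) x}

/-- A link `𝓛` in a 3-manifold `M` is very admissible if it has countably many tame components
and, for each finite cover `f : N → M` branched over a finite sublink (`N` again being a closed
connected 3-manifold), `H₁(N)` is generated by the classes of the components `J` of `f⁻¹(𝓛)`, that
is, by the images of the cyclic groups `H₁(J)`. -/
structure IsVeryAdmissible {M : Type} [TopologicalSpace M] {ι : Type} (K : ι → Set M) :
    Prop where
  link : IsTameLink K
  generates : ∀ (N : Type) [TopologicalSpace N] [T2Space N] [CompactSpace N] [ConnectedSpace N]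
    [ChartedSpace (EuclideanSpace ℝ (Fin 3)) N] (s : Finset ι) (f : N → M),
    IsBranchedCover f (⋃ i ∈ s, K i) →
    ⨆ j : PreimageIndex f K, AddMonoidHom.range (H1.map (subsetIncl (preimageKnot f K j))) = ⊤

/-! ### Idèle groups -/

/-- The subgroup `ℤ[μ]` of `H₁(∂V)` generated by the meridian of a solid torus `V`: the kernel of
`H₁(∂V) → H₁(V)`. (`V` is closed; the closure only makes `∂V ⊆ closure V` hold by definition.) -/
def meridianSubgroup {X : Type} [TopologicalSpace X] (V : Set X) :
    AddSubgroup (H1 (frontier V)) :=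
  AddMonoidHom.ker (H1.mapOn (continuous_id (X := X))
    (show Set.MapsTo id (frontier V) (closure V) from frontier_subset_closure))

/-- The idèle group of a link whose components, indexed by `ι`, have tubular neighbourhoods `V i`:
the families `(a i)` with `a i ∈ H₁(∂(V i))`, almost all of which are multiples of the meridian. -/
def ideleGroup {X : Type} [TopologicalSpace X] {ι : Type} (V : ι → Set X) :
    AddSubgroup (∀ i, H1 (frontier (V i))) where
  carrier := {a | {i | a i ∉ meridianSubgroup (V i)}.Finite}
  zero_mem' := by
    refine Set.finite_empty.subset fun i hi => ?_
    exact hi (meridianSubgroup (V i)).zero_mem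
  add_mem' := by
    intro a b ha hb
    refine (Set.Finite.union ha hb).subset fun i hi => ?_
    by_contra h
    have h1 : a i ∈ meridianSubgroup (V i) := by
      by_contra h'
      exact h (Or.inl h')
    have h2 : b i ∈ meridianSubgroup (V i) := by
      by_contra h'
      exact h (Or.inr h')
    exact hi ((meridianSubgroup (V i)).add_mem h1 h2)
  neg_mem' := by
    intro a ha
    refine Set.Finite.subset ha fun i hi h => ?_
    exact hi ((meridianSubgroup (V i)).neg_mem h)

/-- A map of pairs `(V, ∂V) → (W, ∂W)` takes meridians to multiples of the meridian. -/
theorem mapOn_mem_meridianSubgroup {X Y : Type} [TopologicalSpace X] [TopologicalSpace Y]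
    {f : X → Y} (hf : Continuous f) {V : Set X} {W : Set Y}
    (h : Set.MapsTo f (frontier V) (frontier W)) (h' : Set.MapsTo f (closure V) (closure W))
    {a : H1 (frontier V)} (ha : a ∈ meridianSubgroup V) :
    H1.mapOn hf h a ∈ meridianSubgroup W := by
  have ha' := AddMonoidHom.mem_ker.mp ha
  refine AddMonoidHom.mem_ker.mpr ?_
  have e := congrArg (H1.mapOn hf h') ha'
  rw [map_zero] at e
  rw [← e]
  simp only [H1.mapOn, H1.map_map]
  rfl

/-! ### The action of the Galois group on idèles -/

section Action

variable {M N : Type} [TopologicalSpace N] {ι : Type}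

/-- An automorphism over `M` restricts to a self-map of each preimage. -/
theorem deckGroup_mapsTo {f : N → M} (g : deckGroup f) (S : Set M) :
    Set.MapsTo (g : N ≃ₜ N) (f ⁻¹' S) (f ⁻¹' S) := fun x hx => by
  have h : f ((g : N ≃ₜ N) x) = f x := g.2 x
  change f _ ∈ S
  rw [h]
  exact hx

/-- The Galois group permutes the components of `f⁻¹(S)`. -/
def deckComp {f : N → M} (g : deckGroup f) {S : Set M} :
    ConnectedComponents (f ⁻¹' S) → ConnectedComponents (f ⁻¹' S) :=
  Continuous.connectedComponentsMap
    ((g : N ≃ₜ N).continuous.restrict (deckGroup_mapsTo g S))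

theorem deckComp_one {f : N → M} {S : Set M} (c : ConnectedComponents (f ⁻¹' S)) :
    deckComp (1 : deckGroup f) c = c := by
  obtain ⟨x, rfl⟩ := ConnectedComponents.surjective_coe c
  rfl

theorem deckComp_mul {f : N → M} {S : Set M} (g h : deckGroup f)
    (c : ConnectedComponents (f ⁻¹' S)) : deckComp (g * h) c = deckComp g (deckComp h c) := by
  obtain ⟨x, rfl⟩ := ConnectedComponents.surjective_coe c
  rfl

/-- The Galois group permutes the components of `f⁻¹(𝓛)`. -/
def deckIndex {f : N → M} (g : deckGroup f) {K : ι → Set M} (j : PreimageIndex f K) :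
    PreimageIndex f K :=
  ⟨j.1, deckComp g j.2⟩

theorem deckIndex_one {f : N → M} {K : ι → Set M} (j : PreimageIndex f K) :
    deckIndex (1 : deckGroup f) j = j :=
  Sigma.ext rfl (heq_of_eq (deckComp_one j.2))

theorem deckIndex_mul {f : N → M} {K : ι → Set M} (g h : deckGroup f) (j : PreimageIndex f K) :
    deckIndex (g * h) j = deckIndex g (deckIndex h j) :=
  Sigma.ext rfl (heq_of_eq (deckComp_mul g h j.2))

theorem deckIndex_inv_cancel {f : N → M} {K : ι → Set M} (g : deckGroup f)
    (j : PreimageIndex f K) : deckIndex g (deckIndex g⁻¹ j) = j := by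
  rw [← deckIndex_mul, mul_inv_cancel, deckIndex_one]

theorem deckIndex_cancel_inv {f : N → M} {K : ι → Set M} (g : deckGroup f)
    (j : PreimageIndex f K) : deckIndex g⁻¹ (deckIndex g j) = j := by
  rw [← deckIndex_mul, inv_mul_cancel, deckIndex_one]

theorem deck_mapsTo_preimageKnot {f : N → M} {K : ι → Set M} (g : deckGroup f)
    (j : PreimageIndex f K) :
    Set.MapsTo (g : N ≃ₜ N) (preimageKnot f K j) (preimageKnot f K (deckIndex g j)) := by
  rintro x ⟨hx, hj⟩
  refine ⟨deckGroup_mapsTo g _ hx, ?_⟩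
  exact (congrArg (deckComp g) hj :)

theorem deck_mapsTo_preimageNbhd {f : N → M} {K : ι → Set M} (V : ι → Set M) (g : deckGroup f)
    (j : PreimageIndex f K) :
    Set.MapsTo (g : N ≃ₜ N) (preimageNbhd f K V j) (preimageNbhd f K V (deckIndex g j)) := by
  rintro y ⟨x, hx, hy⟩
  refine ⟨(g : N ≃ₜ N) x, deck_mapsTo_preimageKnot g j hx, ?_⟩
  have hxV : x ∈ f ⁻¹' V j.1 := by
    by_contra h
    rw [connectedComponentIn_eq_empty h] at hy
    exact hy
  have hsub : (g : N ≃ₜ N) '' connectedComponentIn (f ⁻¹' V j.1) x ⊆ f ⁻¹' V j.1 :=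
    ((deckGroup_mapsTo g (V j.1)).mono_left (connectedComponentIn_subset _ _)).image_subset
  exact (isPreconnected_connectedComponentIn.image _
    (g : N ≃ₜ N).continuous.continuousOn).subset_connectedComponentIn
    ⟨x, mem_connectedComponentIn hxV, rfl⟩ hsub ⟨y, hy, rfl⟩

theorem deck_mapsTo_closure {f : N → M} {K : ι → Set M} (V : ι → Set M) (g : deckGroup f)
    {j j' : PreimageIndex f K} (h : deckIndex g j = j') :
    Set.MapsTo (g : N ≃ₜ N) (closure (preimageNbhd f K V j))
      (closure (preimageNbhd f K V j')) := by
  subst h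
  exact (deck_mapsTo_preimageNbhd V g j).closure (g : N ≃ₜ N).continuous

theorem deck_mapsTo_frontier {f : N → M} {K : ι → Set M} (V : ι → Set M) (g : deckGroup f)
    {j j' : PreimageIndex f K} (h : deckIndex g j = j') :
    Set.MapsTo (g : N ≃ₜ N) (frontier (preimageNbhd f K V j))
      (frontier (preimageNbhd f K V j')) := by
  intro x hx
  refine ⟨deck_mapsTo_closure V g h hx.1, fun hi => hx.2 ?_⟩
  have hinv : Set.MapsTo ((g⁻¹ : deckGroup f) : N ≃ₜ N) (preimageNbhd f K V j')
      (preimageNbhd f K V j) := by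
    have := deck_mapsTo_preimageNbhd V g⁻¹ j'
    rwa [← h, deckIndex_cancel_inv, h] at this
  refine mem_interior.mpr ⟨(g : N ≃ₜ N) ⁻¹' interior (preimageNbhd f K V j'), ?_,
    isOpen_interior.preimage (g : N ≃ₜ N).continuous, hi⟩
  intro y hy
  have hy' := hinv (interior_subset hy)
  have e : ((g⁻¹ : deckGroup f) : N ≃ₜ N) ((g : N ≃ₜ N) y) = y :=
    (g : N ≃ₜ N).symm_apply_apply y
  rwa [e] at hy'

/-- The action of `g` on families: `(g a)_J = g_*(a_{g⁻¹ J})`. -/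
def deckFamily {f : N → M} {K : ι → Set M} (V : ι → Set M) (g : deckGroup f)
    (a : ∀ j : PreimageIndex f K, H1 (frontier (preimageNbhd f K V j)))
    (j : PreimageIndex f K) : H1 (frontier (preimageNbhd f K V j)) :=
  H1.mapOn (g : N ≃ₜ N).continuous (deck_mapsTo_frontier V g (deckIndex_inv_cancel g j))
    (a (deckIndex g⁻¹ j))

theorem deckFamily_eq {f : N → M} {K : ι → Set M} (V : ι → Set M) (g : deckGroup f)
    (a : ∀ j : PreimageIndex f K, H1 (frontier (preimageNbhd f K V j)))
    {j j' : PreimageIndex f K} (h : deckIndex g j' = j) :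
    deckFamily V g a j = H1.mapOn (g : N ≃ₜ N).continuous (deck_mapsTo_frontier V g h) (a j') := by
  have e : j' = deckIndex g⁻¹ j := by rw [← h, deckIndex_cancel_inv]
  subst e
  rfl

/-- The Galois group acts on the idèle group of `(N, f⁻¹(𝓛))`, taking the `J`-component to the
`gJ`-component by `g_* : H₁(∂V_J) → H₁(∂V_{gJ})`. -/
def ideleRep (f : N → M) (K V : ι → Set M) :
    Representation ℤ (deckGroup f) (ideleGroup (preimageNbhd f K V)) where
  toFun g :=
    AddMonoidHom.toIntLinearMap
    { toFun := fun a => ⟨deckFamily V g a.1, by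
        refine (a.2.image (deckIndex g)).subset fun j hj => ?_
        refine ⟨deckIndex g⁻¹ j, fun h => hj ?_, deckIndex_inv_cancel g j⟩
        exact mapOn_mem_meridianSubgroup _ _
          (deck_mapsTo_closure V g (deckIndex_inv_cancel g j)) h⟩
      map_zero' := Subtype.ext (funext fun j => map_zero _)
      map_add' := fun a b => Subtype.ext (funext fun j => map_add _ _ _) }
  map_one' := by
    refine LinearMap.ext fun a => Subtype.ext (funext fun j => ?_)
    refine (deckFamily_eq V 1 a.1 (deckIndex_one j)).trans ?_
    exact H1.map_id _
  map_mul' := by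
    intro g h
    refine LinearMap.ext fun a => Subtype.ext (funext fun j => ?_)
    have e : deckIndex (g * h) (deckIndex h⁻¹ (deckIndex g⁻¹ j)) = j := by
      rw [deckIndex_mul, deckIndex_inv_cancel, deckIndex_inv_cancel]
    refine (deckFamily_eq V (g * h) a.1 e).trans ?_
    symm
    exact H1.map_map _ _ _

end Action

/-! ### The map `f_*` on idèles -/

section Pushforward

variable {M N : Type} [TopologicalSpace M] [TopologicalSpace N] {ι : Type}

theorem mapsTo_closure_preimageNbhd {f : N → M} (hf : Continuous f) (K V : ι → Set M)
    (j : PreimageIndex f K) :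
    Set.MapsTo f (closure (preimageNbhd f K V j)) (closure (V j.1)) := by
  refine Set.MapsTo.closure (fun y hy => ?_) hf
  obtain ⟨x, -, hy⟩ := hy
  exact connectedComponentIn_subset (f ⁻¹' V j.1) x hy

theorem mapsTo_frontier_preimageNbhd [LocallyConnectedSpace N] {f : N → M} (hf : Continuous f)
    (K V : ι → Set M) (j : PreimageIndex f K) :
    Set.MapsTo f (frontier (preimageNbhd f K V j)) (frontier (V j.1)) := by
  intro y hy
  refine ⟨mapsTo_closure_preimageNbhd hf K V j hy.1, fun hi => hy.2 ?_⟩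
  have hO : IsOpen (f ⁻¹' interior (V j.1)) := isOpen_interior.preimage hf
  have hU := hO.connectedComponentIn (x := y)
  have hyU : y ∈ connectedComponentIn (f ⁻¹' interior (V j.1)) y := mem_connectedComponentIn hi
  obtain ⟨w, hwU, x, hx, hw⟩ := mem_closure_iff.mp hy.1 _ hU hyU
  refine mem_interior.mpr ⟨_, fun z hz => ⟨x, hx, ?_⟩, hU, hyU⟩
  rw [connectedComponentIn_eq hw]
  exact isPreconnected_connectedComponentIn.subset_connectedComponentIn hwU
    ((connectedComponentIn_subset _ _).trans (Set.preimage_mono interior_subset)) hz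

/-- The homomorphism `f_*` from the idèle group of `(N, f⁻¹(𝓛))` to that of `(M, 𝓛)`: the
`K i`-component of `f_*(a)` is the sum, over the (finitely many) components `J` of `f⁻¹(K i)`, of
the images of `a_J` under `f_* : H₁(∂V_J) → H₁(∂(V i))`. -/
def idelePush [LocallyConnectedSpace N] {f : N → M} (hf : Continuous f) (K V : ι → Set M)
    [∀ i, Finite (ConnectedComponents (f ⁻¹' K i))] :
    ideleGroup (preimageNbhd f K V) →+ ideleGroup V where
  toFun a := ⟨fun i => ∑ᶠ c : ConnectedComponents (f ⁻¹' K i),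
      H1.mapOn hf (mapsTo_frontier_preimageNbhd hf K V ⟨i, c⟩) (a.1 ⟨i, c⟩), by
    refine (a.2.image Sigma.fst).subset fun i hi => ?_
    by_contra h
    refine hi (finsum_induction (· ∈ meridianSubgroup (V i)) (AddSubgroup.zero_mem _)
      (fun x y => AddSubgroup.add_mem _) fun c => ?_)
    refine mapOn_mem_meridianSubgroup hf _ (mapsTo_closure_preimageNbhd hf K V ⟨i, c⟩) ?_
    by_contra h'
    exact h ⟨⟨i, c⟩, h', rfl⟩⟩
  map_add' a b := Subtype.ext (funext fun i => by
    refine Eq.trans (finsum_congr fun c => map_add _ _ _) ?_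
    exact finsum_add_distrib (Set.toFinite _) (Set.toFinite _))
  map_zero' := Subtype.ext (funext fun i =>
    (finsum_congr fun c => map_zero _).trans finsum_zero)

end Pushforward

/-! ### Finiteness of the number of components over a knot -/

theorem finite_connectedComponents_of_nhds {X : Type} [TopologicalSpace X] [CompactSpace X]
    (h : ∀ x : X, ∃ U ∈ 𝓝 x, IsPreconnected U) : Finite (ConnectedComponents X) := by
  choose U hU hc using h
  obtain ⟨t, ht⟩ := CompactSpace.elim_nhds_subcover U hU
  refine Finite.of_surjective (fun x : t => ConnectedComponents.mk x.1) fun c => ?_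
  obtain ⟨y, rfl⟩ := ConnectedComponents.surjective_coe c
  have hy : y ∈ ⋃ x ∈ t, U x := ht ▸ Set.mem_univ y
  obtain ⟨x, hx, hyx⟩ := Set.mem_iUnion₂.mp hy
  refine ⟨⟨x, hx⟩, ?_⟩
  exact (ConnectedComponents.coe_eq_coe'.mpr
    ((hc x).subset_connectedComponent (mem_of_mem_nhds (hU x)) hyx)).symm

theorem IsTameKnot.isCompact {M : Type} [TopologicalSpace M] {K : Set M} (h : IsTameKnot K) :
    IsCompact K := by
  obtain ⟨V, φ, hφ, rfl, -⟩ := h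
  exact (isCompact_singleton.prod isCompact_univ).image hφ.continuous

/-- Over each component of a tame link, a branched cover by a compact space has only finitely many
components. -/
theorem IsBranchedCover.finite_components {M N : Type} [TopologicalSpace M] [T2Space M]
    [TopologicalSpace N] [CompactSpace N] {ι : Type} {K : ι → Set M} (hK : IsTameLink K)
    {s : Finset ι} {f : N → M} (hf : IsBranchedCover f (⋃ i ∈ s, K i)) (i : ι) :
    Finite (ConnectedComponents (f ⁻¹' K i)) := by
  classical
  have hcl : ∀ k, IsClosed (K k) := fun k => (hK.tame k).isCompact.isClosed
  have : CompactSpace (f ⁻¹' K i) :=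
    isCompact_iff_compactSpace.mp ((hcl i).preimage hf.continuous).isCompact
  suffices H : ∀ y ∈ f ⁻¹' K i, ∃ U : Set N, IsOpen U ∧ y ∈ U ∧
      IsPreconnected (U ∩ f ⁻¹' K i) by
    refine finite_connectedComponents_of_nhds fun y => ?_
    obtain ⟨U, hU, hy, hc⟩ := H y.1 y.2
    refine ⟨Subtype.val ⁻¹' U, (hU.preimage continuous_subtype_val).mem_nhds hy, ?_⟩
    rw [← IsInducing.subtypeVal.isPreconnected_image, Subtype.image_preimage_coe,
      Set.inter_comm]
    exact hc
  intro y hy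
  by_cases hyL : f y ∈ ⋃ i ∈ s, K i
  · obtain ⟨φ, ψ, e, he, hyφ, hφ0, hmaps, hloc, hax⟩ := hf.local_model y hyL
    have his : i ∈ s := by
      obtain ⟨k, hk, hyk⟩ := Set.mem_iUnion₂.mp hyL
      by_contra h
      have hne : i ≠ k := fun e => h (e ▸ hk)
      exact Set.disjoint_left.mp (hK.disjoint hne) hy hyk
    set O : Set M := (⋃ k ∈ (s.erase i : Finset ι), K k)ᶜ with hOdef
    have hO : IsOpen O :=
      (Set.Finite.isClosed_biUnion (s.erase i).finite_toSet fun k _ => hcl k).isOpen_compl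
    have hyO : f y ∈ O := by
      intro h
      obtain ⟨k, hk, hyk⟩ := Set.mem_iUnion₂.mp h
      exact Set.disjoint_left.mp (hK.disjoint (Finset.ne_of_mem_erase hk).symm) hy hyk
    have hOK : ∀ x ∈ O, (x ∈ ⋃ i ∈ s, K i) ↔ x ∈ K i := by
      intro x hx
      constructor
      · intro h
        obtain ⟨k, hk, hxk⟩ := Set.mem_iUnion₂.mp h
        by_cases hki : k = i
        · exact hki ▸ hxk
        · exact absurd (Set.mem_iUnion₂.mpr ⟨k, Finset.mem_erase.mpr ⟨hki, hk⟩, hxk⟩) hx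
      · exact fun h => Set.mem_iUnion₂.mpr ⟨i, his, h⟩
    have hP : IsOpen (φ.target ∩ φ.symm ⁻¹' (f ⁻¹' O)) :=
      φ.symm.isOpen_inter_preimage (hO.preimage hf.continuous)
    have h0P : (0 : ℂ × ℝ) ∈ φ.target ∩ φ.symm ⁻¹' (f ⁻¹' O) := by
      rw [← hφ0]
      refine ⟨φ.map_source hyφ, ?_⟩
      change f (φ.symm (φ y)) ∈ O
      rwa [φ.left_inv hyφ]
    obtain ⟨ε, hε, hball⟩ := Metric.isOpen_iff.mp hP 0 h0P
    refine ⟨φ.source ∩ φ ⁻¹' Metric.ball 0 ε, φ.isOpen_inter_preimage Metric.isOpen_ball,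
      ⟨hyφ, by simpa [hφ0] using hε⟩, ?_⟩
    have hset : (φ.source ∩ φ ⁻¹' Metric.ball 0 ε) ∩ f ⁻¹' K i =
        φ.symm '' ({0} ×ˢ Metric.ball (0 : ℝ) ε) := by
      ext x
      constructor
      · rintro ⟨⟨hxs, hxb⟩, hxK⟩
        have hx1 : (φ x).1 = 0 := by
          have h1 := (hax (f x) (hmaps hxs)).mp (Set.mem_iUnion₂.mpr ⟨i, his, hxK⟩)
          rw [hloc x hxs] at h1
          exact pow_eq_zero_iff he.ne' |>.mp h1
        refine ⟨φ x, ⟨hx1, ?_⟩, φ.left_inv hxs⟩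
        have h2 : φ x ∈ Metric.ball (0 : ℂ × ℝ) ε := hxb
        rw [← Prod.mk_zero_zero, ← ball_prod_same] at h2
        exact h2.2
      · rintro ⟨p, ⟨hp1, hp2⟩, rfl⟩
        have hpb : p ∈ Metric.ball (0 : ℂ × ℝ) ε := by
          rw [← Prod.mk_zero_zero, ← ball_prod_same]
          exact ⟨by rw [Set.mem_singleton_iff.mp hp1]; exact Metric.mem_ball_self hε, hp2⟩
        obtain ⟨hpt, hpO⟩ := hball hpb
        have hps := φ.map_target hpt
        refine ⟨⟨hps, ?_⟩, ?_⟩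
        · change φ (φ.symm p) ∈ Metric.ball (0 : ℂ × ℝ) ε
          rwa [φ.right_inv hpt]
        · refine (hOK _ hpO).mp ((hax _ (hmaps hps)).mpr ?_)
          rw [hloc _ hps, φ.right_inv hpt, Set.mem_singleton_iff.mp hp1]
          exact zero_pow he.ne'
    rw [hset]
    refine (isPreconnected_singleton.prod (convex_ball (0 : ℝ) ε).isPreconnected).image _
      (φ.continuousOn_symm.mono ?_)
    rintro p ⟨hp1, hp2⟩
    suffices h : p ∈ Metric.ball (0 : ℂ × ℝ) ε from (hball h).1
    rw [← Prod.mk_zero_zero, ← ball_prod_same]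
    exact ⟨by rw [Set.mem_singleton_iff.mp hp1]; exact Metric.mem_ball_self hε, hp2⟩
  · obtain ⟨e, hye, hfe⟩ := hf.covering.isLocalHomeomorphOn y hyL
    obtain ⟨V, φ, hφ, hφK, -⟩ := hK.tame i
    obtain ⟨⟨p0, z⟩, ⟨hp0, -⟩, hz⟩ : f y ∈ φ '' ({0} ×ˢ Set.univ) := hφK ▸ hy
    have hp0' : p0 = 0 := hp0
    subst hp0'
    have : LocallyConnectedSpace Circle :=
      ChartedSpace.locallyConnectedSpace (EuclideanSpace ℝ (Fin 1)) Circle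
    have hφc : Continuous fun w : Circle => φ (0, w) := hφ.continuous.comp (by fun_prop)
    have hB : IsOpen ((fun w : Circle => φ (0, w)) ⁻¹' e.target) := e.open_target.preimage hφc
    have hzB : z ∈ (fun w : Circle => φ (0, w)) ⁻¹' e.target := by
      change φ (0, z) ∈ e.target
      rw [hz, hfe]
      exact e.map_source hye
    set A := connectedComponentIn ((fun w : Circle => φ (0, w)) ⁻¹' e.target) z with hA
    have hAo : IsOpen A := hB.connectedComponentIn
    have hAt : ∀ w ∈ A, φ (0, w) ∈ e.target := fun w hw =>
      connectedComponentIn_subset ((fun w : Circle => φ (0, w)) ⁻¹' e.target) z hw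
    refine ⟨e.source ∩ f ⁻¹' (φ '' (Set.univ ×ˢ A)), e.open_source.inter
      ((hφ.isOpenMap _ (isOpen_univ.prod hAo)).preimage hf.continuous),
      ⟨hye, ⟨(0, z), ⟨trivial, mem_connectedComponentIn hzB⟩, hz⟩⟩, ?_⟩
    have hset : (e.source ∩ f ⁻¹' (φ '' (Set.univ ×ˢ A))) ∩ f ⁻¹' K i =
        (fun w : Circle => e.symm (φ (0, w))) '' A := by
      ext x
      constructor
      · rintro ⟨⟨hxs, ⟨q, w⟩, ⟨-, hw⟩, hqw⟩, hxK⟩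
        obtain ⟨⟨q', w'⟩, ⟨hq', -⟩, hqw'⟩ : f x ∈ φ '' ({0} ×ˢ Set.univ) := hφK ▸ hxK
        have heq := hφ.injective (hqw.trans hqw'.symm)
        have hq0 : q = 0 := (Prod.mk.inj heq).1.trans hq'
        refine ⟨w, hw, ?_⟩
        change e.symm (φ (0, w)) = x
        rw [← hq0, hqw, hfe, e.left_inv hxs]
      · rintro ⟨w, hw, rfl⟩
        have hfx : f (e.symm (φ (0, w))) = φ (0, w) := by
          rw [hfe]
          exact e.right_inv (hAt w hw)
        refine ⟨⟨e.map_target (hAt w hw), ?_⟩, ?_⟩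
        · change f (e.symm (φ (0, w))) ∈ φ '' (Set.univ ×ˢ A)
          rw [hfx]
          exact ⟨(0, w), ⟨trivial, hw⟩, rfl⟩
        · change f (e.symm (φ (0, w))) ∈ K i
          rw [hfx, ← hφK]
          exact ⟨(0, w), ⟨rfl, trivial⟩, rfl⟩
    rw [hset]
    exact isPreconnected_connectedComponentIn.image _
      (e.continuousOn_symm.comp hφc.continuousOn fun w hw => hAt w hw)

/-- The homomorphism `f_*` between the idèle groups, for a finite branched cover of closed
3-manifolds. -/
def branchedPush {M N : Type} [TopologicalSpace M] [T2Space M] [TopologicalSpace N]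
    [CompactSpace N] [ChartedSpace (EuclideanSpace ℝ (Fin 3)) N] {ι : Type} {K : ι → Set M}
    (hK : IsTameLink K) {s : Finset ι} {f : N → M} (hf : IsBranchedCover f (⋃ i ∈ s, K i))
    (V : ι → Set M) :
    ideleGroup (preimageNbhd f K V) →+ ideleGroup V :=
  haveI : LocallyConnectedSpace N :=
    ChartedSpace.locallyConnectedSpace (EuclideanSpace ℝ (Fin 3)) N
  haveI := hf.finite_components hK
  idelePush hf.continuous K V

end

/-!
The statement is local on the base: over each knot `K` of the link it concerns only the boundary
tori `∂V_J` of the components `J` of `f⁻¹(K)`, and it rests on three facts.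

* The map `H₁(∂V_J) → H₁(∂V_K)` is injective and `H₁(∂V_K)` is torsion-free
  (`IsBranchedCover.eq_zero_of_zsmul_boundaryPush_eq_zero`): the torus `∂V_J` is a connected
  covering of the torus `∂V_K`, so both are quotients of the same plane `ℝ × ℝ` by groups of
  translations.
* The Galois group permutes the components `J` over `K` transitively
  (`IsBranchedCover.exists_deckComp_eq`).
* A function on a finite set with a transitive cyclic permutation whose values in an abelian group
  sum to zero is a coboundary (`exists_eq_sub_of_sum_eq_zero`).

By the first two facts all the groups `H₁(∂V_J)`, and likewise their meridian subgroups, are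
identified by `f_*` with one subgroup of `H₁(∂V_K)`, on which the Galois group does nothing but
permute the indices `J`. So a family `(a_J)` with `∑ f_*(a_J) = 0` has the form `(τ - 1) b`, and
`b` may be chosen to consist of multiples of meridians if `a` does; this yields idèles `b`. An idèle
`a` of norm zero satisfies `|G| • f_*(a) = 0`, so `f_*(a) = 0` because the groups `H₁(∂V_K)` have no
torsion, whence the vanishing of Tate cohomology.

For the injectivity on `H₁`, let `q : W → E` be a surjection from a vector space that identifies
points exactly when they differ by a period, and through which paths lift. Coning off a lifted path
to the origin shows that it is homologous to a difference of images of straight paths from the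
origin, and these depend additively on periods; hence every class in `H₁(E)` is the image of the
straight path to some period (`H1.exists_radialClass`). Conversely, if `p = f ∘ q` is a map through
which paths and triangles lift, with well defined displacements, the displacement of a lift is a
homomorphism on `H₁` that recovers the period (`exists_displacement`).

That `∂V_J` is connected is proved by lifting the universal covering
`(z, t) ↦ φ (exp z, exp (i t))` of the punctured solid torus to `N`. Its image is a path component
of the preimage of the punctured solid torus. As a knot does not locally disconnect a 3-manifold,
the component `V_J` contains only one of these (`IsTubularChart.mem_range_lift_polar`).
-/

/-! ### Singular chains and first homology modulo boundaries -/

noncomputable section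
open CategoryTheory AlgebraicTopology Simplicial

/-- The standard topological `n`-simplex. -/
abbrev TopSimplex (n : ℕ) : Type := stdSimplex ℝ (Fin (n + 1))

/-- The inclusion of the `i`-th face of the standard `(n + 1)`-simplex. -/
def topFace {n : ℕ} (i : Fin (n + 2)) : C(TopSimplex n, TopSimplex (n + 1)) :=
  ⟨stdSimplex.map i.succAbove, stdSimplex.continuous_map _⟩

/-- The singular chain given by a single singular simplex. -/
def simplexChain {X : Type} [TopologicalSpace X] {n : ℕ} (σ : C(TopSimplex n, X)) :
    (singChains X).X n :=
  ((TopCat.toSSet.obj (TopCat.of X)).ιChainComplex (R := AddCommGrpCat.of ℤ)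
    (((TopCat.of X).toSSetObjEquiv (.op ⦋n⦌)).symm σ)).hom (1 : ℤ)

theorem singChains_d_simplexChain {X : Type} [TopologicalSpace X] {n : ℕ}
    (σ : C(TopSimplex (n + 1), X)) :
    ((singChains X).d (n + 1) n).hom (simplexChain σ) =
      ∑ i : Fin (n + 2), (-1 : ℤ) ^ i.val • simplexChain (σ.comp (topFace i)) := by
  let ev : (AddCommGrpCat.of ℤ ⟶ (singChains X).X n) →+ (singChains X).X n :=
    { toFun := fun m => m.hom (1 : ℤ), map_zero' := rfl, map_add' := fun _ _ => rfl }
  have h := (TopCat.toSSet.obj (TopCat.of X)).ιChainComplex_d (AddCommGrpCat.of ℤ)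
    (((TopCat.of X).toSSetObjEquiv (.op ⦋n + 1⦌)).symm σ)
  exact (congrArg ev h).trans ((map_sum ev _ _).trans
    (Finset.sum_congr rfl fun i _ => map_zsmul ev _ _))

theorem singChainsMap_simplexChain {X Y : Type} [TopologicalSpace X] [TopologicalSpace Y] {n : ℕ}
    (f : C(X, Y)) (σ : C(TopSimplex n, X)) :
    ((singChainsMap f).f n).hom (simplexChain σ) = simplexChain (f.comp σ) :=
  congrArg (fun m => m.hom (1 : ℤ)) (SSet.ι_chainComplexMap_f (TopCat.toSSet.obj (TopCat.of X))
    (TopCat.toSSet.obj (TopCat.of Y)) (TopCat.toSSet.map (TopCat.ofHom f)) (AddCommGrpCat.of ℤ)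
    (((TopCat.of X).toSSetObjEquiv (.op ⦋n⦌)).symm σ))

/-- Singular chains are generated by the simplices. -/
theorem singChains_hom_ext {X : Type} [TopologicalSpace X] {n : ℕ} {A : Type} [AddCommGroup A]
    {φ ψ : (singChains X).X n →+ A} (h : ∀ σ, φ (simplexChain σ) = ψ (simplexChain σ)) :
    φ = ψ := by
  have : AddCommGrpCat.ofHom (Y := AddCommGrpCat.of A) φ = AddCommGrpCat.ofHom ψ := by
    refine SSet.chainComplex_hom_ext fun x => ?_
    refine AddCommGrpCat.hom_ext (AddMonoidHom.ext_int ?_)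
    have := h ((TopCat.of X).toSSetObjEquiv (.op ⦋n⦌) x)
    rwa [simplexChain, Equiv.symm_apply_apply] at this
  exact congrArg (fun m => m.hom) this

/-- Homomorphisms from singular chains may be prescribed on the simplices. -/
theorem exists_singChains_hom {X : Type} [TopologicalSpace X] {n : ℕ} {A : Type} [AddCommGroup A]
    (F : C(TopSimplex n, X) → A) :
    ∃ φ : (singChains X).X n →+ A, ∀ σ, φ (simplexChain σ) = F σ := by
  let c : Limits.Cofan (fun _ : (TopCat.toSSet.obj (TopCat.of X)).obj (.op ⦋n⦌) =>
      AddCommGrpCat.of ℤ) := Limits.Cofan.mk (AddCommGrpCat.of A) fun x =>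
    AddCommGrpCat.ofHom (zmultiplesHom A (F ((TopCat.of X).toSSetObjEquiv (.op ⦋n⦌) x)))
  let L := SSet.isColimitChainComplexXCofan (TopCat.toSSet.obj (TopCat.of X))
    (AddCommGrpCat.of ℤ) n
  refine ⟨(L.desc c).hom, fun σ => ?_⟩
  have h := L.fac c ⟨((TopCat.of X).toSSetObjEquiv (.op ⦋n⦌)).symm σ⟩
  have h' := congrArg (fun m => m.hom (1 : ℤ)) h
  refine h'.trans ?_
  simp [c]

/-- The group `C₁(X) / ∂ C₂(X)`, of which `H₁(X)` is a subgroup. Unlike `H₁(X)`, it is generated by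
classes of single paths. -/
abbrev Chains1ModBoundaries (X : Type) [TopologicalSpace X] : AddCommGrpCat.{0} :=
  (singChains X).opcycles 1

/-- The class of a singular `1`-simplex (not necessarily a cycle) modulo boundaries. -/
def pathClass {X : Type} [TopologicalSpace X] (σ : C(TopSimplex 1, X)) :
    Chains1ModBoundaries X :=
  ((singChains X).pOpcycles 1).hom (simplexChain σ)

/-- The boundary of a singular triangle. -/
theorem pathClass_face_one {X : Type} [TopologicalSpace X] (τ : C(TopSimplex 2, X)) :
    pathClass (τ.comp (topFace 1)) = pathClass (τ.comp (topFace 0)) +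
      pathClass (τ.comp (topFace 2)) := by
  have h := congrArg (fun m => m.hom (simplexChain τ)) ((singChains X).d_pOpcycles 2 1)
  have h' : ((singChains X).pOpcycles 1).hom (((singChains X).d 2 1).hom (simplexChain τ)) = 0 := h
  rw [singChains_d_simplexChain, Fin.sum_univ_three] at h'
  simp only [map_add, map_zsmul] at h'
  simp at h'
  change pathClass (τ.comp (topFace 0)) + -pathClass (τ.comp (topFace 1)) +
    pathClass (τ.comp (topFace 2)) = 0 at h'
  rw [← sub_eq_zero, ← neg_eq_zero, ← h']
  abel

theorem exists_chains1ModBoundaries_hom {X : Type} [TopologicalSpace X] {A : Type}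
    [AddCommGroup A] (F : C(TopSimplex 1, X) → A)
    (hF : ∀ τ : C(TopSimplex 2, X), F (τ.comp (topFace 1)) =
      F (τ.comp (topFace 0)) + F (τ.comp (topFace 2))) :
    ∃ φ : Chains1ModBoundaries X →+ A, ∀ σ, φ (pathClass σ) = F σ := by
  obtain ⟨φ, hφ⟩ := exists_singChains_hom F
  have h0 : (singChains X).d 2 1 ≫ AddCommGrpCat.ofHom (Y := AddCommGrpCat.of A) φ = 0 := by
    refine AddCommGrpCat.hom_ext (singChains_hom_ext fun τ => ?_)
    change φ (((singChains X).d 2 1).hom (simplexChain τ)) = 0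
    rw [singChains_d_simplexChain, Fin.sum_univ_three]
    simp [hφ, hF]
  refine ⟨((singChains X).descOpcycles _ 2 (by simp) h0).hom, fun σ => ?_⟩
  have h := (singChains X).p_descOpcycles _ 2 (by simp) h0
  exact (congrArg (fun m => m.hom (simplexChain σ)) h).trans (hφ σ)

/-- The inclusion of `H₁(X)` into `C₁(X) / ∂ C₂(X)`. -/
def H1.toModBoundaries (X : Type) [TopologicalSpace X] : H1 X →+ Chains1ModBoundaries X :=
  ((singChains X).homologyι 1).hom

theorem H1.toModBoundaries_injective (X : Type) [TopologicalSpace X] :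
    Function.Injective (H1.toModBoundaries X) :=
  (AddCommGrpCat.mono_iff_injective _).mp (inferInstanceAs (Mono ((singChains X).homologyι 1)))

/-- Any class in `H₁(X)` is represented by a cycle. -/
theorem H1.exists_cycle {X : Type} [TopologicalSpace X] (z : H1 X) :
    ∃ c : (singChains X).X 1, ((singChains X).d 1 0).hom c = 0 ∧
      ((singChains X).pOpcycles 1).hom c = H1.toModBoundaries X z := by
  obtain ⟨c, hc⟩ := (AddCommGrpCat.epi_iff_surjective ((singChains X).pOpcycles 1)).mp inferInstance
    (H1.toModBoundaries X z)
  refine ⟨c, ?_, hc⟩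
  have h := congrArg (fun m => m.hom c) ((singChains X).p_fromOpcycles 1 0)
  refine h.symm.trans ?_
  change ((singChains X).fromOpcycles 1 0).hom (((singChains X).pOpcycles 1).hom c) = 0
  rw [hc]
  exact congrArg (fun m => m.hom z) ((singChains X).homologyι_comp_fromOpcycles 1 0)

/-- The map induced on `C₁ / ∂ C₂`. -/
def chains1ModBoundariesMap {X Y : Type} [TopologicalSpace X] [TopologicalSpace Y] (f : C(X, Y)) :
    Chains1ModBoundaries X →+ Chains1ModBoundaries Y :=
  (HomologicalComplex.opcyclesMap (singChainsMap f) 1).hom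

theorem chains1ModBoundariesMap_pathClass {X Y : Type} [TopologicalSpace X] [TopologicalSpace Y]
    (f : C(X, Y)) (σ : C(TopSimplex 1, X)) :
    chains1ModBoundariesMap f (pathClass σ) = pathClass (f.comp σ) := by
  have h := congrArg (fun m => m.hom (simplexChain σ))
    (HomologicalComplex.p_opcyclesMap (singChainsMap f) 1)
  refine Eq.trans h ?_
  exact congrArg ((singChains Y).pOpcycles 1).hom (singChainsMap_simplexChain f σ)

theorem H1.toModBoundaries_map {X Y : Type} [TopologicalSpace X] [TopologicalSpace Y] (f : C(X, Y))
    (z : H1 X) : H1.toModBoundaries Y (H1.map f z) =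
      chains1ModBoundariesMap f (H1.toModBoundaries X z) :=
  congrArg (fun m => m.hom z) (HomologicalComplex.homologyι_naturality (singChainsMap f) 1)

end

/-! ### First homology of quotients of a vector space by periods -/

noncomputable section

theorem topFace_apply {n : ℕ} (i : Fin (n + 2)) (t : TopSimplex n) (k : Fin (n + 2)) :
    topFace i t k = ∑ j, if i.succAbove j = k then t j else 0 := by
  change (stdSimplex.map i.succAbove t : Fin (n + 2) → ℝ) k = _
  rw [stdSimplex.map_coe, FunOnFinite.linearMap_apply_apply, Finset.sum_filter]

@[simp] theorem topFace_succAbove {n : ℕ} (i : Fin (n + 2)) (t : TopSimplex n) (j : Fin (n + 1)) :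
    topFace i t (i.succAbove j) = t j := by
  rw [topFace_apply, Finset.sum_eq_single j] <;> simp +contextual

@[simp] theorem topFace_self {n : ℕ} (i : Fin (n + 2)) (t : TopSimplex n) :
    topFace i t i = 0 := by
  rw [topFace_apply]
  exact Finset.sum_eq_zero fun j _ => if_neg (Fin.succAbove_ne i j)

section Faces

variable (t : TopSimplex 1)

theorem topFace_zero_one : topFace 0 t 1 = t 0 := topFace_succAbove 0 t 0
theorem topFace_zero_two : topFace 0 t 2 = t 1 := topFace_succAbove 0 t 1
theorem topFace_one_zero : topFace 1 t 0 = t 0 := topFace_succAbove 1 t 0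
theorem topFace_one_two : topFace 1 t 2 = t 1 := topFace_succAbove 1 t 1
theorem topFace_two_zero : topFace 2 t 0 = t 0 := topFace_succAbove 2 t 0
theorem topFace_two_one : topFace 2 t 1 = t 1 := topFace_succAbove 2 t 1

end Faces


/-- The vertices of the standard `1`-simplex. -/
abbrev topVertex (k : Fin 2) : TopSimplex 1 := stdSimplex.vertex k

theorem topFace_zero_default : topFace 0 (default : TopSimplex 0) = topVertex 1 := by
  ext k
  fin_cases k
  · change topFace 0 (default : TopSimplex 0) 0 = _
    simp [stdSimplex.vertex_coe]
  · exact (topFace_succAbove 0 (default : TopSimplex 0) 0).trans (by simp)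

theorem topFace_one_default : topFace 1 (default : TopSimplex 0) = topVertex 0 := by
  ext k
  fin_cases k
  · exact (topFace_succAbove 1 (default : TopSimplex 0) 0).trans (by simp)
  · change topFace 1 (default : TopSimplex 0) 1 = _
    simp [stdSimplex.vertex_coe]

theorem topFace_topVertex (i : Fin 3) (k : Fin 2) :
    topFace i (topVertex k) = stdSimplex.vertex (i.succAbove k) :=
  stdSimplex.map_vertex _ _

theorem TopSimplex.continuous_apply {n : ℕ} (k : Fin (n + 1)) :
    Continuous fun t : TopSimplex n => t k :=
  (_root_.continuous_apply k).comp continuous_subtype_val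

/-- The point of the standard `1`-simplex with given last coordinate. -/
def topPoint (x : ℝ) (h0 : 0 ≤ x) (h1 : x ≤ 1) : TopSimplex 1 :=
  ⟨![1 - x, x], by
    refine ⟨fun k => ?_, by simp⟩
    fin_cases k
    · simpa using h1
    · simpa using h0⟩

theorem topPoint_eq (t : TopSimplex 1) (x : ℝ) (h0 : 0 ≤ x) (h1 : x ≤ 1) (h : x = t 1) :
    topPoint x h0 h1 = t := by
  subst h
  have := stdSimplex.add_eq_one t
  ext k
  fin_cases k
  · change 1 - t 1 = t 0
    linarith
  · rfl

section Cone

variable {W : Type} [AddCommGroup W] [Module ℝ W] [TopologicalSpace W] [ContinuousAdd W]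
  [ContinuousSMul ℝ W]

/-- The straight segment between two points. -/
def straightPath (x y : W) : C(TopSimplex 1, W) where
  toFun t := t 0 • x + t 1 • y
  continuous_toFun := ((TopSimplex.continuous_apply 0).smul continuous_const).add
    ((TopSimplex.continuous_apply 1).smul continuous_const)

/-- The affine triangle spanned by three points. -/
def affineTriangle (x y z : W) : C(TopSimplex 2, W) where
  toFun t := t 0 • x + t 1 • y + t 2 • z
  continuous_toFun := (((TopSimplex.continuous_apply 0).smul continuous_const).add
    ((TopSimplex.continuous_apply 1).smul continuous_const)).add
    ((TopSimplex.continuous_apply 2).smul continuous_const)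

/-- A singular triangle with first vertex `0`, whose edge opposite to that vertex is `σ` and whose
two other edges are straight. The formula avoids the division by `1 - t 0` of the usual cone. -/
def coneTriangle (σ : C(TopSimplex 1, W)) : C(TopSimplex 2, W) where
  toFun t := t 1 • σ (topPoint (t 2) (stdSimplex.zero_le _ _) (stdSimplex.le_one _ _)) +
    t 2 • σ (topPoint (1 - t 1) (sub_nonneg.mpr (stdSimplex.le_one _ _))
      (sub_le_self _ (stdSimplex.zero_le _ _)))
  continuous_toFun := by
    have h : ∀ (g : TopSimplex 2 → ℝ) (h0 : ∀ t, 0 ≤ g t) (h1 : ∀ t, g t ≤ 1), Continuous g →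
        Continuous fun t => σ (topPoint (g t) (h0 t) (h1 t)) := by
      intro g h0 h1 hg
      refine σ.continuous.comp (Continuous.subtype_mk (continuous_pi fun k => ?_) _)
      fin_cases k
      · exact continuous_const.sub hg
      · exact hg
    exact ((TopSimplex.continuous_apply 1).smul (h _ _ _ (TopSimplex.continuous_apply 2))).add
      ((TopSimplex.continuous_apply 2).smul
        (h _ _ _ (continuous_const.sub (TopSimplex.continuous_apply 1))))

theorem coneTriangle_face_zero (σ : C(TopSimplex 1, W)) :
    (coneTriangle σ).comp (topFace 0) = σ := by
  ext t
  have h := stdSimplex.add_eq_one t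
  change topFace 0 t 1 • σ (topPoint _ _ _) + topFace 0 t 2 • σ (topPoint _ _ _) = σ t
  rw [topPoint_eq t _ _ _ (topFace_zero_two t),
    topPoint_eq t _ _ _ (by rw [topFace_zero_one]; linarith),
    topFace_zero_one, topFace_zero_two, ← add_smul, h, one_smul]

theorem coneTriangle_face_one (σ : C(TopSimplex 1, W)) :
    (coneTriangle σ).comp (topFace 1) = straightPath 0 (σ (topVertex 1)) := by
  ext t
  change topFace 1 t 1 • σ (topPoint _ _ _) + topFace 1 t 2 • σ (topPoint _ _ _) =
    t 0 • 0 + t 1 • _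
  rw [topPoint_eq (topVertex 1) (1 - topFace 1 t 1) _ _ (by simp),
    topFace_self, zero_smul, topFace_one_two]
  simp

theorem coneTriangle_face_two (σ : C(TopSimplex 1, W)) :
    (coneTriangle σ).comp (topFace 2) = straightPath 0 (σ (topVertex 0)) := by
  ext t
  change topFace 2 t 1 • σ (topPoint _ _ _) + topFace 2 t 2 • σ (topPoint _ _ _) =
    t 0 • 0 + t 1 • _
  rw [topPoint_eq (topVertex 0) (topFace 2 t 2) _ _ (by simp),
    topFace_self, zero_smul, topFace_two_one]
  simp

theorem affineTriangle_face_zero (x y z : W) :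
    (affineTriangle x y z).comp (topFace 0) = straightPath y z := by
  ext t
  change topFace 0 t 0 • x + topFace 0 t 1 • y + topFace 0 t 2 • z = t 0 • y + t 1 • z
  simp [topFace_zero_one, topFace_zero_two]

theorem affineTriangle_face_one (x y z : W) :
    (affineTriangle x y z).comp (topFace 1) = straightPath x z := by
  ext t
  change topFace 1 t 0 • x + topFace 1 t 1 • y + topFace 1 t 2 • z = t 0 • x + t 1 • z
  simp [topFace_one_zero, topFace_one_two]

theorem affineTriangle_face_two (x y z : W) :
    (affineTriangle x y z).comp (topFace 2) = straightPath x y := by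
  ext t
  change topFace 2 t 0 • x + topFace 2 t 1 • y + topFace 2 t 2 • z = t 0 • x + t 1 • y
  simp [topFace_two_zero, topFace_two_one]

variable {E : Type} [TopologicalSpace E]

/-- The class in `C₁(E) / ∂ C₂(E)` of the image of the straight path from `0` to `w`. -/
def radialClass (q : C(W, E)) (w : W) : Chains1ModBoundaries E :=
  pathClass (q.comp (straightPath 0 w))

/-- Coning off a path to the origin shows that it is homologous to a difference of straight paths
from the origin. -/
theorem pathClass_comp_eq_sub (q : C(W, E)) (σ : C(TopSimplex 1, W)) :
    pathClass (q.comp σ) =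
      radialClass q (σ (topVertex 1)) - radialClass q (σ (topVertex 0)) := by
  have h := pathClass_face_one (q.comp (coneTriangle σ))
  simp only [ContinuousMap.comp_assoc, coneTriangle_face_zero, coneTriangle_face_one,
    coneTriangle_face_two] at h
  exact eq_sub_of_add_eq h.symm

/-- The class of straight paths is additive on periods. -/
theorem radialClass_add (q : C(W, E)) {γ : W} (hγ : ∀ z, q (z + γ) = q z) (w : W) :
    radialClass q (w + γ) = radialClass q w + radialClass q γ := by
  have h := pathClass_face_one (q.comp (affineTriangle 0 γ (w + γ)))
  simp only [ContinuousMap.comp_assoc, affineTriangle_face_zero, affineTriangle_face_one,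
    affineTriangle_face_two] at h
  have e : q.comp (straightPath γ (w + γ)) = q.comp (straightPath 0 w) := by
    ext t
    change q (t 0 • γ + t 1 • (w + γ)) = q (t 0 • 0 + t 1 • w)
    rw [← hγ (t 0 • 0 + t 1 • w)]
    congr 1
    have h1 : t 0 = 1 - t 1 := eq_sub_of_add_eq (stdSimplex.add_eq_one t)
    rw [h1]
    module
  rw [e] at h
  exact h

/-- The additive group of periods of a map. -/
def periodSubgroup (q : W → E) : AddSubgroup W where
  carrier := {γ | ∀ z, q (z + γ) = q z}
  zero_mem' z := by rw [add_zero]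
  add_mem' {a b} ha hb z := by rw [← add_assoc, hb, ha]
  neg_mem' {a} ha z := by rw [← ha (z + -a), neg_add_cancel_right]

/-- Let `q : W → E` be a surjection from a real vector space that identifies two points only if
their difference is a period, and through which all paths can be lifted. Then all of `H₁(E)` comes
from the images of straight paths from `0` to a period. -/
theorem H1.exists_radialClass (q : C(W, E)) (hq : Function.Surjective q)
    (hper : ∀ x y, q x = q y → y - x ∈ periodSubgroup q)
    (hlift : ∀ σ : C(TopSimplex 1, E), ∃ σ' : C(TopSimplex 1, W), q.comp σ' = σ) (z : H1 E) :
    ∃ γ ∈ periodSubgroup q, H1.toModBoundaries E z = radialClass q γ := by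
  -- a set-theoretic section of `q`, and a lift of each path
  choose s hs using hq
  choose ℓ hℓ using hlift
  let lam : periodSubgroup q →+ Chains1ModBoundaries E :=
    AddMonoidHom.mk' (fun γ => radialClass q γ.1) fun a b => radialClass_add q b.2 a.1
  have hmem : ∀ w, w - s (q w) ∈ periodSubgroup q := fun w => hper _ _ (hs _)
  let dev : W → periodSubgroup q := fun w => ⟨w - s (q w), hmem w⟩
  have hrad : ∀ w, radialClass q w = radialClass q (s (q w)) + lam (dev w) := by
    intro w
    have h := radialClass_add q (hmem w) (s (q w))
    rwa [add_sub_cancel] at h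
  obtain ⟨φ, hφ⟩ := exists_singChains_hom fun σ : C(TopSimplex 1, E) =>
    dev (ℓ σ (topVertex 1)) - dev (ℓ σ (topVertex 0))
  obtain ⟨u, hu⟩ := exists_singChains_hom fun x : C(TopSimplex 0, E) =>
    radialClass q (s (x default))
  -- the straightening of a chain differs from it by a boundary
  have key : ((singChains E).pOpcycles 1).hom =
      lam.comp φ + u.comp ((singChains E).d 1 0).hom := by
    refine singChains_hom_ext fun σ => ?_
    change pathClass σ = lam (φ (simplexChain σ)) +
      u (((singChains E).d 1 0).hom (simplexChain σ))
    rw [singChains_d_simplexChain, Fin.sum_univ_two, hφ]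
    have h0 : q (ℓ σ (topVertex 0)) = σ (topVertex 0) := DFunLike.congr_fun (hℓ σ) _
    have h1 : q (ℓ σ (topVertex 1)) = σ (topVertex 1) := DFunLike.congr_fun (hℓ σ) _
    conv_lhs => rw [← hℓ σ, pathClass_comp_eq_sub, hrad, hrad (ℓ σ (topVertex 0)), h0, h1]
    simp only [Fin.val_zero, Fin.val_one, pow_zero, pow_one, one_smul, neg_smul, map_add, map_neg,
      map_sub, hu, ContinuousMap.comp_apply, topFace_zero_default, topFace_one_default]
    abel
  obtain ⟨c, hc, hcz⟩ := H1.exists_cycle z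
  refine ⟨(φ c).1, (φ c).2, ?_⟩
  rw [← hcz, key]
  change lam (φ c) + u (((singChains E).d 1 0).hom c) = _
  rw [hc, map_zero, add_zero]
  rfl

/-- Let `p : W → B` be a map from a real vector space through which paths and singular triangles
can be lifted, such that the difference of the endpoints of a lift of a path is unique. Then this
difference is defined on homology classes. -/
theorem exists_displacement {B : Type} [TopologicalSpace B] (p : C(W, B))
    (hlift₁ : ∀ σ : C(TopSimplex 1, B), ∃ σ' : C(TopSimplex 1, W), p.comp σ' = σ)
    (hlift₂ : ∀ σ : C(TopSimplex 2, B), ∃ σ' : C(TopSimplex 2, W), p.comp σ' = σ)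
    (huniq : ∀ σ σ' : C(TopSimplex 1, W), p.comp σ = p.comp σ' →
      σ (topVertex 1) - σ (topVertex 0) = σ' (topVertex 1) - σ' (topVertex 0)) :
    ∃ δ : Chains1ModBoundaries B →+ W, ∀ w, δ (radialClass p w) = w := by
  choose ℓ hℓ using hlift₁
  obtain ⟨δ, hδ⟩ := exists_chains1ModBoundaries_hom
    (fun σ : C(TopSimplex 1, B) => ℓ σ (topVertex 1) - ℓ σ (topVertex 0)) (by
      intro τ
      obtain ⟨τ', rfl⟩ := hlift₂ τ
      simp only [fun i => huniq _ (τ'.comp (topFace i))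
        ((hℓ ((p.comp τ').comp (topFace i))).trans (ContinuousMap.comp_assoc _ _ _)),
        ContinuousMap.comp_apply]
      have e0 : topFace 1 (topVertex 1) = topFace 0 (topVertex 1) := by
        rw [topFace_topVertex, topFace_topVertex]; rfl
      have e1 : topFace 1 (topVertex 0) = topFace 2 (topVertex 0) := by
        rw [topFace_topVertex, topFace_topVertex]; rfl
      have e2 : topFace 0 (topVertex 0) = topFace 2 (topVertex 1) := by
        rw [topFace_topVertex, topFace_topVertex]; rfl
      rw [e0, e1, e2]
      abel)
  refine ⟨δ, fun w => ?_⟩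
  rw [radialClass, hδ, huniq _ _ (hℓ _)]
  simp [straightPath]

/-- Let `q : W → E` present `E` as a quotient of a real vector space by a group of periods, and let
`f : E → B` be such that paths and triangles lift through `f ∘ q`. Then no nonzero class of `H₁(E)`
becomes torsion in `H₁(B)`. For coverings `f` between tori this gives the injectivity of `f_*` and,
with it, that the image is torsion-free. -/
theorem H1.eq_zero_of_zsmul_map_eq_zero {B : Type} [TopologicalSpace B]
    (f : C(E, B)) (q : C(W, E)) (hq : Function.Surjective q)
    (hper : ∀ x y, q x = q y → y - x ∈ periodSubgroup q)
    (hliftq : ∀ σ : C(TopSimplex 1, E), ∃ σ' : C(TopSimplex 1, W), q.comp σ' = σ)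
    (hlift₁ : ∀ σ : C(TopSimplex 1, B), ∃ σ' : C(TopSimplex 1, W), (f.comp q).comp σ' = σ)
    (hlift₂ : ∀ σ : C(TopSimplex 2, B), ∃ σ' : C(TopSimplex 2, W), (f.comp q).comp σ' = σ)
    (huniq : ∀ σ σ' : C(TopSimplex 1, W), (f.comp q).comp σ = (f.comp q).comp σ' →
      σ (topVertex 1) - σ (topVertex 0) = σ' (topVertex 1) - σ' (topVertex 0))
    {n : ℤ} (hn : n ≠ 0) {z : H1 E} (hz : n • H1.map f z = 0) : z = 0 := by
  obtain ⟨γ, -, hγ⟩ := H1.exists_radialClass q hq hper hliftq z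
  obtain ⟨δ, hδ⟩ := exists_displacement (f.comp q) hlift₁ hlift₂ huniq
  have h : H1.toModBoundaries B (H1.map f z) = radialClass (f.comp q) γ := by
    rw [H1.toModBoundaries_map, hγ, radialClass, chains1ModBoundariesMap_pathClass]
    rfl
  have h2 : n • γ = 0 := by
    rw [← hδ γ, ← map_zsmul, ← h, ← map_zsmul, hz, map_zero, map_zero]
  have h3 : (n : ℝ) • γ = 0 := by rw [Int.cast_smul_eq_zsmul, h2]
  have h4 : γ = 0 := (smul_eq_zero.mp h3).resolve_left (Int.cast_ne_zero.mpr hn)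
  refine H1.toModBoundaries_injective E ?_
  have h5 := radialClass_add q (γ := 0) (fun z => by rw [add_zero]) 0
  rw [hγ, h4, map_zero]
  rwa [add_zero, left_eq_add] at h5

end Cone

end

/-! ### Charts of solid tori and polar coordinates on them -/

noncomputable section

/-- An open embedding of the plane into a disc of radius larger than `1` that preserves the origin
and the closed unit disc. -/
theorem exists_isOpenEmbedding_ball {R : ℝ} (hR : 1 < R) :
    ∃ h : ℂ → ℂ, IsOpenEmbedding h ∧ h 0 = 0 ∧ (∀ z, ‖h z‖ < R) ∧
      h '' Metric.closedBall 0 1 = Metric.closedBall 0 1 := by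
  -- rescale the embedding `z ↦ z / √(1 + ‖z‖ ^ 2)` so that the unit circle is preserved
  have hc : 0 < R ^ 2 - 1 := by nlinarith
  have hs : 0 < √(R ^ 2 - 1) := Real.sqrt_pos.mpr hc
  have hR0 : 0 < R := by linarith
  let u : OpenPartialHomeomorph ℂ ℂ := OpenPartialHomeomorph.univUnitBall
  have hu : IsOpenEmbedding u := u.isOpenEmbedding rfl
  have hun : ∀ z, ‖u z‖ ^ 2 = ‖z‖ ^ 2 / (1 + ‖z‖ ^ 2) := by
    intro z
    change ‖(OpenPartialHomeomorph.univUnitBall : OpenPartialHomeomorph ℂ ℂ) z‖ ^ 2 = _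
    rw [OpenPartialHomeomorph.univUnitBall_apply, norm_smul, mul_pow, norm_inv, inv_pow,
      Real.norm_of_nonneg (Real.sqrt_nonneg _), Real.sq_sqrt (by positivity)]
    field_simp
  let h : ℂ → ℂ := fun z => R • u ((√(R ^ 2 - 1))⁻¹ • z)
  have hh : IsOpenEmbedding h := (Homeomorph.smulOfNeZero R hR0.ne').isOpenEmbedding.comp
    (hu.comp (Homeomorph.smulOfNeZero (√(R ^ 2 - 1))⁻¹ (inv_ne_zero hs.ne')).isOpenEmbedding)
  have hn : ∀ z, ‖h z‖ ^ 2 = R ^ 2 * (‖z‖ ^ 2 / (R ^ 2 - 1 + ‖z‖ ^ 2)) := by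
    intro z
    change ‖R • u ((√(R ^ 2 - 1))⁻¹ • z)‖ ^ 2 = _
    rw [norm_smul, mul_pow, hun, norm_smul, mul_pow, norm_inv, inv_pow,
      Real.norm_of_nonneg (Real.sqrt_nonneg _), Real.sq_sqrt hc.le, Real.norm_of_nonneg hR0.le]
    field_simp
  have hlt : ∀ z, ‖h z‖ < R := by
    intro z
    refine lt_of_pow_lt_pow_left₀ 2 hR0.le ?_
    rw [hn]
    have h1 : ‖z‖ ^ 2 / (R ^ 2 - 1 + ‖z‖ ^ 2) < 1 := by
      rw [div_lt_one (by positivity)]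
      linarith
    nlinarith [pow_pos hR0 2]
  have hle : ∀ z, ‖h z‖ ≤ 1 ↔ ‖z‖ ≤ 1 := by
    intro z
    rw [← sq_le_one_iff₀ (norm_nonneg _), ← sq_le_one_iff₀ (norm_nonneg z), hn, ← mul_div_assoc,
      div_le_one (by positivity)]
    constructor <;> intro h <;> nlinarith
  refine ⟨h, hh, ?_, hlt, ?_⟩
  · change R • u ((√(R ^ 2 - 1))⁻¹ • 0) = 0
    rw [smul_zero]
    exact (congrArg (R • ·) OpenPartialHomeomorph.univUnitBall_apply_zero).trans (smul_zero R)
  · ext w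
    constructor
    · rintro ⟨z, hz, rfl⟩
      rw [mem_closedBall_zero_iff] at hz ⊢
      exact (hle z).mpr hz
    · intro hw
      rw [mem_closedBall_zero_iff] at hw
      have hw' : R⁻¹ • w ∈ u.target := by
        change R⁻¹ • w ∈ Metric.ball 0 1
        rw [mem_ball_zero_iff, norm_smul, norm_inv, Real.norm_of_nonneg hR0.le,
          inv_mul_lt_one₀ hR0]
        linarith
      have hz : h (√(R ^ 2 - 1) • u.symm (R⁻¹ • w)) = w := by
        change R • u ((√(R ^ 2 - 1))⁻¹ • √(R ^ 2 - 1) • u.symm (R⁻¹ • w)) = w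
        rw [inv_smul_smul₀ hs.ne', u.right_inv hw', smul_inv_smul₀ hR0.ne']
      refine ⟨_, ?_, hz⟩
      rw [mem_closedBall_zero_iff, ← hle, hz]
      exact hw

/-- `φ` is a chart on an open solid torus around the knot `K` in which `V` is the standard closed
solid torus and which avoids the set `C`. -/
structure IsTubularChart {M : Type} [TopologicalSpace M] (φ : ℂ × Circle → M) (V K C : Set M) :
    Prop where
  isOpenEmbedding : IsOpenEmbedding φ
  image_core : φ '' ({0} ×ˢ Set.univ) = K
  image_closedBall : φ '' (Metric.closedBall 0 1 ×ˢ Set.univ) = V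
  notMem : ∀ p, φ p ∉ C

/-- The chart of a tubular neighbourhood can be shrunk so as to avoid a closed set disjoint from
the neighbourhood. -/
theorem IsTubularNeighborhood.exists_isTubularChart {M : Type} [TopologicalSpace M]
    {V K C : Set M} (h : IsTubularNeighborhood V K) (hC : IsClosed C) (hVC : Disjoint V C) :
    ∃ φ, IsTubularChart φ V K C := by
  obtain ⟨φ, hφ, hK, hV⟩ := h
  have hO : IsOpen (φ ⁻¹' Cᶜ) := hC.isOpen_compl.preimage hφ.continuous
  have hsub : Metric.closedBall (0 : ℂ) 1 ×ˢ (Set.univ : Set Circle) ⊆ φ ⁻¹' Cᶜ := fun p hp hpC =>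
    Set.disjoint_left.mp hVC (hV ▸ Set.mem_image_of_mem φ hp) hpC
  obtain ⟨u, v, hu, -, hbu, hv, huv⟩ := generalized_tube_lemma
    (isCompact_closedBall (0 : ℂ) 1) isCompact_univ hO hsub
  obtain ⟨ε, hε, hεu⟩ := (isCompact_closedBall (0 : ℂ) 1).exists_thickening_subset_open hu hbu
  rw [thickening_closedBall hε zero_le_one] at hεu
  obtain ⟨g, hg, hg0, hgR, hgb⟩ := exists_isOpenEmbedding_ball (R := ε + 1) (by linarith)
  have himg : ∀ S : Set ℂ, (φ ∘ Prod.map g id) '' (S ×ˢ Set.univ) =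
      φ '' ((g '' S) ×ˢ (Set.univ : Set Circle)) := by
    intro S
    rw [Set.image_comp, Set.prodMap_image_prod, Set.image_id]
  refine ⟨φ ∘ Prod.map g id, hφ.comp (hg.prodMap .id), ?_, ?_, fun p => ?_⟩
  · rw [himg, Set.image_singleton, hg0, hK]
  · rw [himg, hgb, hV]
  · exact huv (Set.mk_mem_prod (hεu (mem_ball_zero_iff.mpr (hgR p.1))) (hv trivial))

namespace IsTubularChart

variable {M : Type} [TopologicalSpace M] {φ : ℂ × Circle → M} {V K C : Set M}
  (h : IsTubularChart φ V K C)
include h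

theorem mem_core_iff (p : ℂ × Circle) : φ p ∈ K ↔ p.1 = 0 := by
  rw [← h.image_core, h.isOpenEmbedding.injective.mem_set_image]
  simp

theorem mem_tube_iff (p : ℂ × Circle) : φ p ∈ V ↔ ‖p.1‖ ≤ 1 := by
  rw [← h.image_closedBall, h.isOpenEmbedding.injective.mem_set_image]
  simp

theorem tube_subset_range : V ⊆ Set.range φ := by
  rw [← h.image_closedBall]
  exact Set.image_subset_range _ _

theorem core_subset_tube : K ⊆ V := by
  rw [← h.image_core, ← h.image_closedBall]
  refine Set.image_mono (Set.prod_mono_left ?_)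
  simp

theorem isCompact_tube : IsCompact V := by
  rw [← h.image_closedBall]
  exact ((isCompact_closedBall 0 1).prod isCompact_univ).image h.isOpenEmbedding.continuous

theorem isCompact_core : IsCompact K := by
  rw [← h.image_core]
  exact (isCompact_singleton.prod isCompact_univ).image h.isOpenEmbedding.continuous

theorem mem_frontier_iff (p : ℂ × Circle) : φ p ∈ frontier V ↔ ‖p.1‖ = 1 := by
  have h1 : φ ⁻¹' V = Metric.closedBall 0 1 ×ˢ Set.univ := by
    ext p
    simp [h.mem_tube_iff]
  change p ∈ φ ⁻¹' frontier V ↔ _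
  rw [h.isOpenEmbedding.isOpenMap.preimage_frontier_eq_frontier_preimage
    h.isOpenEmbedding.continuous, h1, frontier_prod_univ_eq, frontier_closedBall _ one_ne_zero]
  simp

theorem frontier_subset_range [T2Space M] : frontier V ⊆ Set.range φ :=
  h.isCompact_tube.isClosed.frontier_subset.trans h.tube_subset_range

/-- The universal covering `(z, t) ↦ φ (exp z, exp (i t))` of the complement of the core in the open
solid torus. -/
def polar : C(ℂ × ℝ, M) where
  toFun w := φ (Complex.exp w.1, Circle.exp w.2)
  continuous_toFun := h.isOpenEmbedding.continuous.comp
    ((Complex.continuous_exp.comp continuous_fst).prodMk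
      (Circle.exp.continuous.comp continuous_snd))

theorem polar_apply (w : ℂ × ℝ) : h.polar w = φ (Complex.exp w.1, Circle.exp w.2) := rfl

theorem polar_mem_range (w : ℂ × ℝ) : h.polar w ∈ Set.range φ \ K :=
  ⟨⟨_, rfl⟩, fun hw => Complex.exp_ne_zero _ ((h.mem_core_iff _).mp hw)⟩

theorem exists_polar_eq {x : M} (hx : x ∈ Set.range φ \ K) : ∃ w, h.polar w = x := by
  obtain ⟨⟨⟨z, t⟩, rfl⟩, hxK⟩ := hx
  have hz : z ≠ 0 := fun h0 => hxK ((h.mem_core_iff _).mpr h0)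
  refine ⟨(Complex.log z, (t : ℂ).arg), ?_⟩
  rw [polar_apply, Complex.exp_log hz, Circle.exp_arg]

/-- Differences of points with the same image are periods of `polar`. -/
theorem polar_add_sub {w w' : ℂ × ℝ} (hw : h.polar w = h.polar w') (v : ℂ × ℝ) :
    h.polar (v + (w' - w)) = h.polar v := by
  have h1 := h.isOpenEmbedding.injective hw
  have h2 : Complex.exp w.1 = Complex.exp w'.1 := congrArg Prod.fst h1
  have h3 : Circle.exp w.2 = Circle.exp w'.2 := congrArg Prod.snd h1
  have h4 : Complex.exp (v + (w' - w)).1 = Complex.exp v.1 := by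
    rw [Prod.fst_add, Prod.fst_sub, Complex.exp_add, Complex.exp_sub, h2,
      div_self (Complex.exp_ne_zero _), mul_one]
  have h5 : Circle.exp (v + (w' - w)).2 = Circle.exp v.2 := by
    rw [Prod.snd_add, Prod.snd_sub, Circle.exp_add, Circle.exp_sub, h3, div_self', mul_one]
  rw [polar_apply, polar_apply, h4, h5]

theorem exists_lift_polar {A : Type} [TopologicalSpace A] [SimplyConnectedSpace A]
    [LocallyPathConnectedSpace A] (g : C(A, M)) (hg : ∀ a, g a ∈ Set.range φ \ K) (a₀ : A)
    (w₀ : ℂ × ℝ) (h₀ : h.polar w₀ = g a₀) :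
    ∃ g' : C(A, ℂ × ℝ), h.polar.comp g' = g ∧ g' a₀ = w₀ := by
  let e : ℂ × Circle ≃ₜ Set.range φ := h.isOpenEmbedding.isEmbedding.toHomeomorph
  let k : C(A, ℂ × Circle) := ⟨fun a => e.symm ⟨g a, (hg a).1⟩,
    e.symm.continuous.comp (g.continuous.subtype_mk _)⟩
  have hk : ∀ a, φ (k a) = g a := fun a => congrArg Subtype.val (e.apply_symm_apply ⟨g a, (hg a).1⟩)
  have hk0 : ∀ a, (k a).1 ∈ ({0}ᶜ : Set ℂ) := fun a h0 =>
    (hg a).2 (hk a ▸ (h.mem_core_iff _).mpr h0)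
  have hw : (Complex.exp w₀.1, Circle.exp w₀.2) = k a₀ :=
    h.isOpenEmbedding.injective (h₀.trans (hk a₀).symm)
  obtain ⟨F, ⟨hF0, hF⟩, -⟩ := Complex.isCoveringMapOn_exp.existsUnique_continuousMap_lifts
    (⟨fun a => (k a).1, continuous_fst.comp k.continuous⟩ : C(A, ℂ)) (a₀ := a₀) (e₀ := w₀.1)
    (congrArg Prod.fst hw) hk0
  obtain ⟨G, ⟨hG0, hG⟩, -⟩ := Circle.isCoveringMap_exp.existsUnique_continuousMap_lifts
    (⟨fun a => (k a).2, continuous_snd.comp k.continuous⟩ : C(A, Circle)) a₀ w₀.2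
    (congrArg Prod.snd hw)
  refine ⟨F.prodMk G, ?_, Prod.ext hF0 hG0⟩
  ext a
  have h1 : Complex.exp (F a) = (k a).1 := congrFun hF a
  have h2 : Circle.exp (G a) = (k a).2 := congrFun hG a
  change φ (Complex.exp (F a), Circle.exp (G a)) = g a
  rw [h1, h2, ← hk a]

theorem lift_polar_unique {A : Type} [TopologicalSpace A] [PreconnectedSpace A]
    {g g' : C(A, ℂ × ℝ)} (hg : h.polar.comp g = h.polar.comp g') {a₀ : A} (h₀ : g a₀ = g' a₀) :
    g = g' := by
  have h1 : ∀ a, Complex.exp (g a).1 = Complex.exp (g' a).1 ∧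
      Circle.exp (g a).2 = Circle.exp (g' a).2 := fun a =>
    Prod.ext_iff.mp (h.isOpenEmbedding.injective (DFunLike.congr_fun hg a))
  have h2 := Complex.isCoveringMap_exp.eq_of_comp_eq (continuous_fst.comp g.continuous)
    (continuous_fst.comp g'.continuous) (funext fun a => Subtype.ext (h1 a).1) a₀
    (congrArg Prod.fst h₀)
  have h3 := Circle.isCoveringMap_exp.eq_of_comp_eq (continuous_snd.comp g.continuous)
    (continuous_snd.comp g'.continuous) (funext fun a => (h1 a).2) a₀ (congrArg Prod.snd h₀)
  ext1 a
  exact Prod.ext (congrFun h2 a) (congrFun h3 a)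

/-- Two lifts of the same map have the same displacements. -/
theorem lift_polar_sub_eq {A : Type} [TopologicalSpace A] [PreconnectedSpace A]
    {g g' : C(A, ℂ × ℝ)} (hg : h.polar.comp g = h.polar.comp g') (a b : A) :
    g b - g a = g' b - g' a := by
  have h1 : h.polar.comp (g + ContinuousMap.const A (g' a - g a)) = h.polar.comp g' := by
    rw [← hg]
    ext b
    exact h.polar_add_sub (DFunLike.congr_fun hg a) (g b)
  have h2 := DFunLike.congr_fun (h.lift_polar_unique h1 (a₀ := a) (add_sub_cancel _ _)) b
  change g b + (g' a - g a) = g' b at h2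
  rw [← h2]
  abel

theorem polar_mem_frontier_iff (w : ℂ × ℝ) : h.polar w ∈ frontier V ↔ w.1.re = 0 := by
  rw [polar_apply, h.mem_frontier_iff, Complex.norm_exp, Real.exp_eq_one_iff]

theorem frontier_subset [T2Space M] : frontier V ⊆ Set.range φ \ K := by
  intro x hx
  obtain ⟨p, rfl⟩ := h.frontier_subset_range hx
  refine ⟨⟨p, rfl⟩, fun hp => ?_⟩
  rw [h.mem_frontier_iff, (h.mem_core_iff p).mp hp, norm_zero] at hx
  exact zero_ne_one hx

theorem isOpen_range_diff : IsOpen (Set.range φ \ K) := by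
  have : Set.range φ \ K = φ '' ({0}ᶜ ×ˢ Set.univ) := by
    ext x
    constructor
    · rintro ⟨⟨p, rfl⟩, hp⟩
      exact ⟨p, ⟨fun h0 => hp ((h.mem_core_iff p).mpr h0), trivial⟩, rfl⟩
    · rintro ⟨p, ⟨hp, -⟩, rfl⟩
      exact ⟨⟨p, rfl⟩, fun h0 => hp ((h.mem_core_iff p).mp h0)⟩
  rw [this]
  exact h.isOpenEmbedding.isOpenMap _ (isOpen_compl_singleton.prod isOpen_univ)

end IsTubularChart

end

/-! ### Coverings of punctured solid tori and their boundary tori -/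

noncomputable section

instance TopSimplex.contractibleSpace (n : ℕ) : ContractibleSpace (TopSimplex n) :=
  (convex_stdSimplex ℝ (Fin (n + 1))).contractibleSpace
    ⟨_, (stdSimplex.vertex 0 : TopSimplex n).2⟩

instance TopSimplex.locallyPathConnectedSpace (n : ℕ) : LocallyPathConnectedSpace (TopSimplex n) :=
  (convex_stdSimplex ℝ (Fin (n + 1))).locallyPathConnectedSpace

theorem isClosed_connectedComponentIn {X : Type} [TopologicalSpace X] {F : Set X} (hF : IsClosed F)
    (x : X) : IsClosed (connectedComponentIn F x) := by
  by_cases hx : x ∈ F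
  · refine isClosed_of_closure_subset ?_
    exact isPreconnected_connectedComponentIn.closure.subset_connectedComponentIn
      (subset_closure (mem_connectedComponentIn hx))
      (closure_minimal (connectedComponentIn_subset F x) hF)
  · rw [connectedComponentIn_eq_empty hx]
    exact isClosed_empty

/-- Two lifts of a map through a covering agree if they agree at one point. -/
theorem IsCoveringMapOn.lift_unique {E X A : Type} [TopologicalSpace E] [TopologicalSpace X]
    [TopologicalSpace A] [PreconnectedSpace A] {f : E → X} {U : Set X} (hf : IsCoveringMapOn f U)
    {g g' : A → E} (hg : Continuous g) (hg' : Continuous g') (hU : ∀ a, f (g a) ∈ U)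
    (h : ∀ a, f (g a) = f (g' a)) {a₀ : A} (h₀ : g a₀ = g' a₀) (a : A) : g a = g' a := by
  have h1 := hf.isCoveringMap_restrictPreimage.eq_of_comp_eq
    (g₁ := fun a => ⟨g a, hU a⟩) (g₂ := fun a => ⟨g' a, (h a ▸ hU a : f (g' a) ∈ U)⟩)
    (hg.subtype_mk _) (hg'.subtype_mk _) (funext fun a => Subtype.ext (h a)) a₀ (Subtype.ext h₀)
  exact congrArg Subtype.val (congrFun h1 a)

namespace IsTubularChart

variable {M : Type} [TopologicalSpace M] {φ : ℂ × Circle → M} {V K C : Set M}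
  (h : IsTubularChart φ V K C) {N : Type} [TopologicalSpace N] {f : N → M}
include h

theorem exists_lift_polar_of_covering (hcov : IsCoveringMapOn f (Set.range φ \ K)) {x : N}
    {w : ℂ × ℝ}     (hw : h.polar w = f x) :
    ∃ P : C(ℂ × ℝ, N), P w = x ∧ ∀ v, f (P v) = h.polar v := by
  obtain ⟨P, ⟨hP0, hP⟩, -⟩ := hcov.existsUnique_continuousMap_lifts h.polar (a₀ := w) (e₀ := x)
    hw.symm h.polar_mem_range
  exact ⟨P, hP0, congrFun hP⟩

/-- Differences of points with the same image are periods of a lift of `polar`. -/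
theorem lift_polar_add_sub (hcov : IsCoveringMapOn f (Set.range φ \ K)) {P : C(ℂ × ℝ, N)}
    (hP : ∀ v, f (P v) = h.polar v) {w w' : ℂ × ℝ} (hw : P w = P w') (v : ℂ × ℝ) :
    P (v + (w' - w)) = P v := by
  have hw' : h.polar w = h.polar w' := by rw [← hP, ← hP, hw]
  refine hcov.lift_unique (g := fun v => P (v + (w' - w))) (g' := P) (a₀ := w) (by fun_prop)
    P.continuous (fun a => hP _ ▸ h.polar_mem_range _) (fun a => ?_) ?_ v
  · rw [hP, hP, h.polar_add_sub hw']
  · rw [add_sub_cancel, hw]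

/-- A lift of the universal covering of the punctured solid torus sweeps out a path component of the
preimage. -/
theorem range_lift_polar (hcov : IsCoveringMapOn f (Set.range φ \ K)) {P : C(ℂ × ℝ, N)}
    (hP : ∀ v, f (P v) = h.polar v) (w : ℂ × ℝ) :
    Set.range P = pathComponentIn (f ⁻¹' (Set.range φ \ K)) (P w) := by
  have hmem : ∀ v, P v ∈ f ⁻¹' (Set.range φ \ K) := fun v => by
    rw [Set.mem_preimage, hP]
    exact h.polar_mem_range v
  ext y
  constructor
  · rintro ⟨v, rfl⟩
    obtain ⟨γ⟩ := PathConnectedSpace.joined w v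
    exact ⟨γ.map P.continuous, fun t => hmem _⟩
  · rintro ⟨γ, hγ⟩
    have : ContractibleSpace unitInterval := (convex_Icc (0 : ℝ) 1).contractibleSpace ⟨0, by simp⟩
    have : LocallyPathConnectedSpace unitInterval :=
      (convex_Icc (0 : ℝ) 1).locallyPathConnectedSpace
    have hc : ContinuousOn f (f ⁻¹' (Set.range φ \ K)) := hcov.continuousOn
    obtain ⟨g, hg, hg0⟩ := h.exists_lift_polar
      (⟨fun t => f (γ t), hc.comp_continuous γ.continuous hγ⟩ : C(unitInterval, M)) hγ 0 w
      (by rw [← hP]; exact congrArg f γ.source.symm)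
    have hfg : ∀ t, f (P (g t)) = f (γ t) := fun t => (hP _).trans (DFunLike.congr_fun hg t)
    refine ⟨g 1, ?_⟩
    refine (hcov.lift_unique (g := fun t => P (g t)) (g' := γ) (a₀ := 0)
      (P.continuous.comp g.continuous) γ.continuous (fun t => hmem _) hfg ?_ 1).trans γ.target
    rw [hg0]
    exact γ.source.symm

/-- If points over the core have small neighbourhoods that the preimage of the core does not
disconnect, then all points off the preimage of the core in a connected set over the solid torus
belong to the same path component. -/
theorem mem_range_lift_polar [LocallyPathConnectedSpace N] (hf : Continuous f)
    (hcov : IsCoveringMapOn f (Set.range φ \ K))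
    (hloc : ∀ y, f y ∈ K → ∃ O : Set N, IsOpen O ∧ y ∈ O ∧ O ⊆ f ⁻¹' Set.range φ ∧
      IsPreconnected (O \ f ⁻¹' K) ∧ O ⊆ closure (O \ f ⁻¹' K))
    {P : C(ℂ × ℝ, N)} (hP : ∀ v, f (P v) = h.polar v) {T : Set N} (hT : IsPreconnected T)
    (hTφ : T ⊆ f ⁻¹' Set.range φ) {w : ℂ × ℝ} (hw : P w ∈ T) {y : N} (hy : y ∈ T)
    (hyK : f y ∉ K) : y ∈ Set.range P := by
  set G : Set N := f ⁻¹' (Set.range φ \ K) with hG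
  have hGo : IsOpen G := h.isOpen_range_diff.preimage hf
  have hTo : IsOpen (f ⁻¹' Set.range φ) := h.isOpenEmbedding.isOpen_range.preimage hf
  have hPG : Set.range P ⊆ G := by
    rw [h.range_lift_polar hcov hP w]
    exact pathComponentIn_subset
  have hPo : IsOpen (Set.range P) := by
    rw [h.range_lift_polar hcov hP w]
    exact hGo.pathComponentIn _
  have hPc : IsOpen (G \ Set.range P) := by
    refine isOpen_iff_mem_nhds.mpr fun x hx => ?_
    refine Filter.mem_of_superset ((hGo.pathComponentIn x).mem_nhds (mem_pathComponentIn_self hx.1))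
      fun x' hx' => ⟨pathComponentIn_subset hx', fun hxP => hx.2 ?_⟩
    rw [h.range_lift_polar hcov hP w] at hxP ⊢
    exact hxP.trans (JoinedIn.symm hx')
  -- inside the part over the open solid torus, the closure of the path component is open
  have hcl : ∀ x ∈ G, x ∈ closure (Set.range P) → x ∈ Set.range P := by
    intro x hx hxc
    by_contra hxP
    obtain ⟨z, hz, hzP⟩ := mem_closure_iff.mp hxc _ hPc ⟨hx, hxP⟩
    exact hz.2 hzP
  have hopen : IsOpen (f ⁻¹' Set.range φ ∩ closure (Set.range P)) := by
    refine isOpen_iff_mem_nhds.mpr fun x hx => ?_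
    by_cases hxK : f x ∈ K
    · obtain ⟨O, hO, hxO, hOφ, hOc, hOd⟩ := hloc x hxK
      obtain ⟨z, hzO, hzP⟩ := mem_closure_iff.mp hx.2 O hO hxO
      have hOG : O \ f ⁻¹' K ⊆ G := fun v hv => ⟨hOφ hv.1, hv.2⟩
      have hsub : O \ f ⁻¹' K ⊆ Set.range P := by
        refine hOc.subset_left_of_subset_union hPo hPc Set.disjoint_sdiff_right ?_
          ⟨z, ⟨hzO, (hPG hzP).2⟩, hzP⟩
        rw [Set.union_sdiff_cancel hPG]
        exact hOG
      exact Filter.mem_of_superset (hO.mem_nhds hxO) fun v hv =>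
        ⟨hOφ hv, closure_mono hsub (hOd hv)⟩
    · have hxP := hcl x ⟨hx.1, hxK⟩ hx.2
      exact Filter.mem_of_superset (hPo.mem_nhds hxP) fun v hv =>
        ⟨(hPG hv).1, subset_closure hv⟩
  have hTcl : T ⊆ f ⁻¹' Set.range φ ∩ closure (Set.range P) := by
    refine hT.subset_left_of_subset_union hopen (hTo.inter isClosed_closure.isOpen_compl)
      (Set.disjoint_left.mpr fun v hv hv' => hv'.2 hv.2) (fun v hv => ?_)
      ⟨P w, hw, hTφ hw, subset_closure ⟨w, rfl⟩⟩
    by_cases hvP : v ∈ closure (Set.range P)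
    · exact Or.inl ⟨hTφ hv, hvP⟩
    · exact Or.inr ⟨hTφ hv, hvP⟩
  exact hcl y ⟨hTφ hy, hyK⟩ (hTcl hy).2

end IsTubularChart

theorem H1.eq_zero_of_isEmpty {X : Type} [TopologicalSpace X] [IsEmpty X] (z : H1 X) : z = 0 := by
  obtain ⟨c, -, hc⟩ := H1.exists_cycle z
  have h : ((singChains X).pOpcycles 1).hom = 0 :=
    singChains_hom_ext fun σ => isEmptyElim (σ (topVertex 0))
  refine H1.toModBoundaries_injective X ?_
  rw [← hc, h, map_zero]
  rfl

/-- The plane `iℝ × ℝ` in `ℂ × ℝ`, which is the part of the universal covering `polar` that lies over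
the boundary of the solid torus. -/
def imAxis : C(ℝ × ℝ, ℂ × ℝ) where
  toFun u := (u.1 * Complex.I, u.2)
  continuous_toFun := by fun_prop

theorem imAxis_sub (u v : ℝ × ℝ) : imAxis (u - v) = imAxis u - imAxis v := by
  refine Prod.ext ?_ rfl
  simp [imAxis, sub_mul]

theorem imAxis_add (u v : ℝ × ℝ) : imAxis (u + v) = imAxis u + imAxis v := by
  refine Prod.ext ?_ rfl
  simp [imAxis, add_mul]

theorem imAxis_injective : Function.Injective imAxis := fun u v h => by
  have h1 := congrArg (fun w : ℂ × ℝ => w.1.im) h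
  have h2 := congrArg (fun w : ℂ × ℝ => w.2) h
  simp only [imAxis, ContinuousMap.coe_mk, Complex.mul_im, Complex.ofReal_re, Complex.I_im,
    Complex.ofReal_im, Complex.I_re, mul_one, mul_zero, add_zero] at h1 h2
  exact Prod.ext h1 h2

/-- A map to the plane `iℝ × ℝ` can be written in coordinates. -/
theorem exists_imAxis_comp_eq {A : Type} [TopologicalSpace A] (g : C(A, ℂ × ℝ))
    (hg : ∀ a, (g a).1.re = 0) : ∃ g' : C(A, ℝ × ℝ), imAxis.comp g' = g := by
  refine ⟨⟨fun a => ((g a).1.im, (g a).2), by fun_prop⟩, ?_⟩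
  ext1 a
  refine Prod.ext (Complex.ext ?_ ?_) rfl
  · simp [imAxis, hg]
  · simp [imAxis]

/-- Let `f` be a covering off the core of a solid torus `V`. For each component of `f⁻¹(V)`, no nonzero
class in `H₁` of its boundary becomes torsion in `H₁(∂V)`. -/
theorem IsTubularChart.eq_zero_of_zsmul_mapOn_eq_zero {M : Type} [TopologicalSpace M] [T2Space M]
    {φ : ℂ × Circle → M} {V K C : Set M} (h : IsTubularChart φ V K C) {N : Type}
    [TopologicalSpace N] [LocallyPathConnectedSpace N] {f : N → M} (hf : Continuous f)
    (hcov : IsCoveringMapOn f (Set.range φ \ K))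
    (hloc : ∀ y, f y ∈ K → ∃ O : Set N, IsOpen O ∧ y ∈ O ∧ O ⊆ f ⁻¹' Set.range φ ∧
      IsPreconnected (O \ f ⁻¹' K) ∧ O ⊆ closure (O \ f ⁻¹' K))
    (x₀ : N) (hmap : Set.MapsTo f (frontier (connectedComponentIn (f ⁻¹' V) x₀)) (frontier V))
    {n : ℤ} (hn : n ≠ 0) {z : H1 (frontier (connectedComponentIn (f ⁻¹' V) x₀))}
    (hz : n • H1.mapOn hf hmap z = 0) : z = 0 := by
  rcases isEmpty_or_nonempty (frontier (connectedComponentIn (f ⁻¹' V) x₀)) with hE | ⟨y₀, hy₀⟩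
  · exact H1.eq_zero_of_isEmpty z
  -- the plane that covers `∂V` lifts to the boundary of the component
  have hVcl : IsClosed (f ⁻¹' V) := h.isCompact_tube.isClosed.preimage hf
  have hDcl : IsClosed (connectedComponentIn (f ⁻¹' V) x₀) := isClosed_connectedComponentIn hVcl x₀
  have hDV : connectedComponentIn (f ⁻¹' V) x₀ ⊆ f ⁻¹' V := connectedComponentIn_subset _ _
  have hU : ∀ {y}, y ∈ frontier (connectedComponentIn (f ⁻¹' V) x₀) → f y ∈ Set.range φ \ K :=
    fun hy => h.frontier_subset (hmap hy)
  obtain ⟨w₀, hw₀⟩ := h.exists_polar_eq (hU hy₀)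
  have hw₀re : w₀.1.re = 0 := (h.polar_mem_frontier_iff w₀).mp (hw₀ ▸ hmap hy₀)
  obtain ⟨P, hP0, hP⟩ := h.exists_lift_polar_of_covering hcov hw₀
  have him : ∀ u, (imAxis u).1.re = 0 := fun u => by simp [imAxis]
  have hfr : ∀ u, f (P (imAxis u)) ∈ frontier V := fun u => by
    rw [hP, h.polar_mem_frontier_iff, him]
  obtain ⟨g₀, hg₀⟩ := exists_imAxis_comp_eq (ContinuousMap.const Unit w₀) fun _ => hw₀re
  have hu₀ : imAxis (g₀ ()) = w₀ := DFunLike.congr_fun hg₀ ()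
  have hmem : ∀ u, P (imAxis u) ∈ frontier (connectedComponentIn (f ⁻¹' V) x₀) := by
    have hsub : Set.range (fun u => P (imAxis u)) ⊆ connectedComponentIn (f ⁻¹' V) x₀ := by
      rw [connectedComponentIn_eq (hDcl.frontier_subset hy₀)]
      refine (isPreconnected_range (by fun_prop)).subset_connectedComponentIn
        ⟨g₀ (), (congrArg P hu₀).trans hP0⟩ ?_
      rintro _ ⟨u, rfl⟩
      exact h.isCompact_tube.isClosed.frontier_subset (hfr u)
    intro u
    refine ⟨subset_closure (hsub ⟨u, rfl⟩), fun hi => (hfr u).2 ?_⟩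
    have hlh : IsLocalHomeomorphOn f (f ⁻¹' (Set.range φ \ K)) := hcov.isLocalHomeomorphOn
    have h1 := hlh.map_nhds_eq (h.frontier_subset (hfr u) : P (imAxis u) ∈ f ⁻¹' (Set.range φ \ K))
    rw [mem_interior_iff_mem_nhds, ← h1, Filter.mem_map]
    exact Filter.mem_of_superset (mem_interior_iff_mem_nhds.mp hi) hDV
  let q : C(ℝ × ℝ, frontier (connectedComponentIn (f ⁻¹' V) x₀)) :=
    ⟨fun u => ⟨P (imAxis u), hmem u⟩, by fun_prop⟩
  let fB : C(frontier (connectedComponentIn (f ⁻¹' V) x₀), frontier V) :=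
    ⟨hmap.restrict f _ _, hf.restrict hmap⟩
  have hfq : ∀ u, (fB (q u) : M) = h.polar (imAxis u) := fun u => hP _
  have hsurj : Function.Surjective q := by
    rintro ⟨y, hy⟩
    obtain ⟨w, hw⟩ := h.mem_range_lift_polar hf hcov hloc hP isPreconnected_connectedComponentIn
      (hDV.trans (Set.preimage_mono h.tube_subset_range)) (w := w₀)
      (hP0 ▸ hDcl.frontier_subset hy₀) (hDcl.frontier_subset hy) (hU hy).2
    have hwre : w.1.re = 0 := by
      rw [← h.polar_mem_frontier_iff, ← hP, hw]
      exact hmap hy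
    obtain ⟨g, hg⟩ := exists_imAxis_comp_eq (ContinuousMap.const Unit w) fun _ => hwre
    have hu : imAxis (g ()) = w := DFunLike.congr_fun hg ()
    exact ⟨g (), Subtype.ext ((congrArg P hu).trans hw)⟩
  have hper : ∀ x y, q x = q y → y - x ∈ periodSubgroup q := by
    intro x y hxy v
    refine Subtype.ext ?_
    change P (imAxis (v + (y - x))) = P (imAxis v)
    rw [imAxis_add, imAxis_sub, h.lift_polar_add_sub hcov hP (congrArg Subtype.val hxy)]
  -- a lift through `polar` of a map to the boundary is a map to the plane `iℝ × ℝ`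
  have hliftB : ∀ {A : Type} [TopologicalSpace A] [SimplyConnectedSpace A]
      [LocallyPathConnectedSpace A] (σ : C(A, frontier V)) (a₀ : A) (u₀ : ℝ × ℝ),
      h.polar (imAxis u₀) = σ a₀ →
      ∃ σ' : C(A, ℝ × ℝ), (fB.comp q).comp σ' = σ ∧ imAxis (σ' a₀) = imAxis u₀ := by
    intro A _ _ _ σ a₀ u₀ h₀
    obtain ⟨g, hg, hg0⟩ := h.exists_lift_polar ((subsetIncl _).comp σ)
      (fun a => h.frontier_subset (σ a).2) a₀ (imAxis u₀) h₀
    have hga : ∀ a, h.polar (g a) = σ a := DFunLike.congr_fun hg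
    obtain ⟨g', hg'⟩ := exists_imAxis_comp_eq g fun a => by
      rw [← h.polar_mem_frontier_iff, hga]
      exact (σ a).2
    have hg'a : ∀ a, imAxis (g' a) = g a := DFunLike.congr_fun hg'
    refine ⟨g', ?_, (hg'a a₀).trans hg0⟩
    ext a
    change (fB (q (g' a)) : M) = σ a
    rw [hfq, hg'a, hga]
  have hlift : ∀ {A : Type} [TopologicalSpace A] [SimplyConnectedSpace A]
      [LocallyPathConnectedSpace A] (σ : C(A, frontier V)),
      ∃ σ' : C(A, ℝ × ℝ), (fB.comp q).comp σ' = σ := by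
    intro A _ _ _ σ
    obtain ⟨a₀⟩ := (inferInstance : Nonempty A)
    obtain ⟨w, hw⟩ := h.exists_polar_eq (h.frontier_subset (σ a₀).2)
    have hwre : w.1.re = 0 := by
      rw [← h.polar_mem_frontier_iff, hw]
      exact (σ a₀).2
    obtain ⟨g, hg⟩ := exists_imAxis_comp_eq (ContinuousMap.const Unit w) fun _ => hwre
    have hu : imAxis (g ()) = w := DFunLike.congr_fun hg ()
    obtain ⟨σ', hσ', -⟩ := hliftB σ a₀ (g ()) (by rw [hu, hw])
    exact ⟨σ', hσ'⟩
  refine H1.eq_zero_of_zsmul_map_eq_zero fB q hsurj hper (fun σ => ?_) hlift hlift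
    (fun σ σ' hσ => ?_) hn hz
  · obtain ⟨u₀, hu₀⟩ := hsurj (σ (topVertex 0))
    obtain ⟨σ', hσ', h0⟩ := hliftB (fB.comp σ) (topVertex 0) u₀ (by
      rw [← hfq, hu₀]
      rfl)
    refine ⟨σ', ?_⟩
    ext a
    refine hcov.lift_unique (g := fun a => (q (σ' a) : N)) (g' := fun a => (σ a : N))
      (a₀ := topVertex 0) (by fun_prop) (by fun_prop) (fun a => hU (q (σ' a)).2)
      (fun a => congrArg Subtype.val (DFunLike.congr_fun hσ' a)) ?_ a
    rw [← hu₀]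
    exact congrArg P h0
  · have h1 := h.lift_polar_sub_eq (g := imAxis.comp σ) (g' := imAxis.comp σ') (by
      ext a
      have := congrArg Subtype.val (DFunLike.congr_fun hσ a)
      exact (hfq (σ a)).symm.trans (this.trans (hfq (σ' a)))) (topVertex 0) (topVertex 1)
    refine imAxis_injective ?_
    rw [imAxis_sub, imAxis_sub]
    exact h1

end

/-! ### Local structure of branched covers -/

noncomputable section

theorem Complex.nhds_zero_le_map_pow {e : ℕ} (he : 0 < e) :
    𝓝 (0 : ℂ) ≤ Filter.map (fun z : ℂ => z ^ e) (𝓝 0) := by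
  -- the open mapping theorem
  have ha : AnalyticAt ℂ (fun z : ℂ => z ^ e) 0 := analyticAt_id.pow e
  rcases ha.eventually_constant_or_nhds_le_map_nhds with h | h
  · exfalso
    have h1 : ∀ᶠ z : ℂ in 𝓝[≠] 0, z ^ e = 0 := by
      refine (h.filter_mono nhdsWithin_le_nhds).mono fun z hz => ?_
      rw [hz, zero_pow he.ne']
    obtain ⟨z, hz, hz0⟩ := (h1.and self_mem_nhdsWithin).exists
    exact hz0 (pow_eq_zero_iff he.ne' |>.mp hz)
  · rwa [zero_pow he.ne'] at h

theorem IsBranchedCover.isOpenMap {M N : Type} [TopologicalSpace M] [TopologicalSpace N]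
    {f : N → M} {L : Set M} (hf : IsBranchedCover f L) : IsOpenMap f := by
  refine IsOpenMap.of_nhds_le fun y => ?_
  by_cases hy : f y ∈ L
  · obtain ⟨φ, ψ, e, he, hyφ, hφ0, hmaps, hloc, -⟩ := hf.local_model y hy
    have hψ0 : ψ (f y) = 0 := by
      rw [hloc y hyφ, hφ0]
      simp [he.ne']
    have h1 : Filter.map f (𝓝 y) = Filter.map (ψ.symm ∘ fun p : ℂ × ℝ => (p.1 ^ e, p.2)) (𝓝 0) := by
      rw [← hφ0, ← φ.map_nhds_eq hyφ, Filter.map_map]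
      refine Filter.map_congr (Filter.mem_of_superset (φ.open_source.mem_nhds hyφ) fun x hx => ?_)
      change f x = ψ.symm ((φ x).1 ^ e, (φ x).2)
      rw [← hloc x hx, ψ.left_inv (hmaps hx)]
    have h2 : (𝓝 (0 : ℂ × ℝ)) ≤ Filter.map (fun p : ℂ × ℝ => (p.1 ^ e, p.2)) (𝓝 0) := by
      rw [← Prod.mk_zero_zero, nhds_prod_eq]
      change _ ≤ Filter.map (Prod.map (fun z : ℂ => z ^ e) id) _
      rw [← Filter.prod_map_map_eq', Filter.map_id]
      exact Filter.prod_mono (Complex.nhds_zero_le_map_pow he) le_rfl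
    rw [h1, ← Filter.map_map]
    refine le_trans ?_ (Filter.map_mono h2)
    rw [← hψ0, ψ.symm_map_nhds_eq (hmaps hyφ)]
  · exact (hf.covering.isLocalHomeomorphOn.map_nhds_eq hy).ge

/-- Points over a component of a link have neighbourhoods with coordinates in which the preimage of
that component is a straight line. -/
theorem IsBranchedCover.exists_flat_chart {M N : Type} [TopologicalSpace M]
    [TopologicalSpace N] {ι : Type} {K : ι → Set M} {s : Finset ι} {f : N → M}
    (hf : IsBranchedCover f (⋃ k ∈ s, K k)) (hK : Pairwise fun i j => Disjoint (K i) (K j)) {i : ι}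
    {V : Set M} {φ : ℂ × Circle → M}
    (h : IsTubularChart φ V (K i) (⋃ k ∈ {k | k ∈ s ∧ k ≠ i}, K k)) {y : N}
    (hy : f y ∈ K i) :
    ∃ (Ψ : ℂ × ℝ → N) (ε : ℝ), 0 < ε ∧ ContinuousOn Ψ (Metric.ball 0 ε) ∧
      IsOpen (Ψ '' Metric.ball 0 ε) ∧ Ψ 0 = y ∧
      ∀ p ∈ Metric.ball 0 ε, f (Ψ p) ∈ Set.range φ ∧ (f (Ψ p) ∈ K i ↔ p.1 = 0) := by
  have hrange : IsOpen (f ⁻¹' Set.range φ) :=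
    h.isOpenEmbedding.isOpen_range.preimage hf.continuous
  have hyφ : f y ∈ Set.range φ := h.tube_subset_range (h.core_subset_tube hy)
  by_cases his : i ∈ s
  · have hL : ∀ x ∈ Set.range φ, x ∈ K i ↔ x ∈ ⋃ k ∈ s, K k := by
      rintro _ ⟨p, rfl⟩
      refine ⟨fun hx => Set.mem_biUnion his hx, fun hx => ?_⟩
      obtain ⟨k, hk, hxk⟩ := Set.mem_iUnion₂.mp hx
      by_contra hxi
      exact h.notMem p (Set.mem_biUnion (show k ∈ {k | k ∈ s ∧ k ≠ i} from
        ⟨hk, fun hki => hxi (hki ▸ hxk)⟩) hxk)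
    obtain ⟨χ, ψ, e, he, hyχ, hχ0, hmaps, hloc, hax⟩ := hf.local_model y ((hL _ hyφ).mp hy)
    have hO : IsOpen (χ.target ∩ χ.symm ⁻¹' (f ⁻¹' Set.range φ)) :=
      χ.symm.isOpen_inter_preimage hrange
    have h0 : (0 : ℂ × ℝ) ∈ χ.target ∩ χ.symm ⁻¹' (f ⁻¹' Set.range φ) := by
      rw [← hχ0]
      refine ⟨χ.map_source hyχ, ?_⟩
      rw [Set.mem_preimage, χ.left_inv hyχ]
      exact hyφ
    obtain ⟨ε, hε, hball⟩ := Metric.isOpen_iff.mp hO 0 h0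
    refine ⟨χ.symm, ε, hε, χ.continuousOn_symm.mono fun p hp => (hball hp).1, ?_, ?_,
      fun p hp => ⟨(hball hp).2, ?_⟩⟩
    · exact χ.symm.isOpen_image_of_subset_source Metric.isOpen_ball fun p hp => (hball hp).1
    · rw [← hχ0, χ.left_inv hyχ]
    · have hps := χ.map_target (hball hp).1
      rw [hL _ (hball hp).2, hax _ (hmaps hps), hloc _ hps, χ.right_inv (hball hp).1]
      exact pow_eq_zero_iff he.ne'
  · have hyL : f y ∉ ⋃ k ∈ s, K k := by
      intro hyL
      obtain ⟨k, hk, hyk⟩ := Set.mem_iUnion₂.mp hyL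
      have hne : i ≠ k := fun e => his (e ▸ hk)
      exact Set.disjoint_left.mp (hK hne) hy hyk
    obtain ⟨e, hye, rfl⟩ := hf.covering.isLocalHomeomorphOn y hyL
    obtain ⟨⟨z, t⟩, hzt⟩ := hyφ
    have hz : z = 0 := (h.mem_core_iff (z, t)).mp (hzt ▸ hy)
    subst hz
    let G : ℂ × ℝ → M := fun p => φ (p.1, t * Circle.exp p.2)
    have hG : Continuous G := h.isOpenEmbedding.continuous.comp
      (continuous_fst.prodMk (continuous_const.mul (Circle.exp.continuous.comp continuous_snd)))
    have hGo : IsOpenMap G := h.isOpenEmbedding.isOpenMap.comp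
      (IsOpenMap.id.prodMap ((isOpenMap_mul_left t).comp isLocalHomeomorph_circleExp.isOpenMap))
    have hG0 : G 0 = e y := by
      change φ (0, t * Circle.exp 0) = e y
      rw [Circle.exp_zero, mul_one, hzt]
    have hO : IsOpen (G ⁻¹' e.target) := e.open_target.preimage hG
    obtain ⟨ε, hε, hball⟩ := Metric.isOpen_iff.mp hO 0 (by
      rw [Set.mem_preimage, hG0]
      exact e.map_source hye)
    refine ⟨fun p => e.symm (G p), ε, hε,
      e.continuousOn_symm.comp hG.continuousOn fun p hp => hball hp, ?_, ?_, fun p hp => ?_⟩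
    · have := e.symm.isOpen_image_of_subset_source (hGo _ Metric.isOpen_ball)
        (Set.image_subset_iff.mpr hball)
      rwa [Set.image_image] at this
    · change e.symm (G 0) = y
      rw [hG0, e.left_inv hye]
    · have hp' : e (e.symm (G p)) = G p := e.right_inv (hball hp)
      rw [hp']
      exact ⟨⟨_, rfl⟩, h.mem_core_iff _⟩

/-- A straight line does not disconnect a ball in `ℂ × ℝ`. -/
theorem isPreconnected_ball_diff_line (ε : ℝ) :
    IsPreconnected {p : ℂ × ℝ | p ∈ Metric.ball 0 ε ∧ p.1 ≠ 0} := by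
  rcases le_or_gt ε 0 with hε | hε
  · rw [Metric.ball_eq_empty.mpr hε]
    simpa using isPreconnected_empty
  have hS : Convex ℝ ({z : ℂ | z.re < Real.log ε} ×ˢ Metric.ball (0 : ℝ) ε) :=
    (convex_halfSpace_re_lt _).prod (convex_ball 0 ε)
  have himg : {p : ℂ × ℝ | p ∈ Metric.ball 0 ε ∧ p.1 ≠ 0} =
      (fun p : ℂ × ℝ => (Complex.exp p.1, p.2)) ''
        ({z : ℂ | z.re < Real.log ε} ×ˢ Metric.ball (0 : ℝ) ε) := by
    have hiff : ∀ z : ℂ, ‖Complex.exp z‖ < ε ↔ z.re < Real.log ε := fun z => by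
      rw [Complex.norm_exp, Real.lt_log_iff_exp_lt hε]
    ext ⟨z, t⟩
    rw [← Prod.mk_zero_zero, ← ball_prod_same]
    constructor
    · rintro ⟨⟨hz, ht⟩, hz0⟩
      have hz1 : Complex.exp (Complex.log z) = z := Complex.exp_log hz0
      refine ⟨(Complex.log z, t), ⟨?_, ht⟩, by simp only [hz1]⟩
      rw [Set.mem_ofPred_eq, ← hiff, hz1]
      exact mem_ball_zero_iff.mp hz
    · rintro ⟨⟨w, u⟩, ⟨hw, hu⟩, hwu⟩
      obtain ⟨rfl, rfl⟩ := Prod.ext_iff.mp hwu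
      exact ⟨⟨mem_ball_zero_iff.mpr ((hiff w).mpr hw), hu⟩, Complex.exp_ne_zero w⟩
  rw [himg]
  exact hS.isPreconnected.image _ (by fun_prop)

theorem ball_subset_closure_diff_line {ε : ℝ} :
    Metric.ball (0 : ℂ × ℝ) ε ⊆ closure {p : ℂ × ℝ | p ∈ Metric.ball 0 ε ∧ p.1 ≠ 0} := by
  have hd : Dense {p : ℂ × ℝ | p.1 ≠ 0} := by
    have := (dense_compl_singleton (0 : ℂ)).prod (dense_univ (X := ℝ))
    refine this.mono fun p hp => hp.1
  exact hd.open_subset_closure_inter Metric.isOpen_ball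

/-- Points over a component of a link have small neighbourhoods that the preimage of this component
does not disconnect. -/
theorem IsBranchedCover.exists_nhds_isPreconnected_diff {M N : Type} [TopologicalSpace M]
    [TopologicalSpace N] {ι : Type} {K : ι → Set M} {s : Finset ι} {f : N → M}
    (hf : IsBranchedCover f (⋃ k ∈ s, K k)) (hK : Pairwise fun i j => Disjoint (K i) (K j)) {i : ι}
    {V : Set M} {φ : ℂ × Circle → M}
    (h : IsTubularChart φ V (K i) (⋃ k ∈ {k | k ∈ s ∧ k ≠ i}, K k)) {y : N} (hy : f y ∈ K i) :
    ∃ O : Set N, IsOpen O ∧ y ∈ O ∧ O ⊆ f ⁻¹' Set.range φ ∧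
      IsPreconnected (O \ f ⁻¹' K i) ∧ O ⊆ closure (O \ f ⁻¹' K i) := by
  obtain ⟨Ψ, ε, hε, hΨ, hO, h0, hp⟩ := hf.exists_flat_chart hK h hy
  have himg : Ψ '' Metric.ball 0 ε \ f ⁻¹' K i =
      Ψ '' {p : ℂ × ℝ | p ∈ Metric.ball 0 ε ∧ p.1 ≠ 0} := by
    ext x
    constructor
    · rintro ⟨⟨p, hpb, rfl⟩, hx⟩
      exact ⟨p, ⟨hpb, fun hp0 => hx ((hp p hpb).2.mpr hp0)⟩, rfl⟩
    · rintro ⟨p, ⟨hpb, hp0⟩, rfl⟩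
      exact ⟨⟨p, hpb, rfl⟩, fun hx => hp0 ((hp p hpb).2.mp hx)⟩
  refine ⟨Ψ '' Metric.ball 0 ε, hO, ⟨0, Metric.mem_ball_self hε, h0⟩, ?_, ?_, ?_⟩
  · rintro _ ⟨p, hpb, rfl⟩
    exact (hp p hpb).1
  · rw [himg]
    exact (isPreconnected_ball_diff_line ε).image _ (hΨ.mono fun p hp => hp.1)
  · rw [himg]
    rintro _ ⟨p, hpb, rfl⟩
    have hpc := ball_subset_closure_diff_line hpb
    exact ((hΨ p hpb).mono fun p hp => hp.1).mem_closure_image hpc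

/-- A solid torus that meets the branch locus at most in its core is unbranched off the core. -/
theorem IsTubularChart.range_diff_subset_compl {M : Type} [TopologicalSpace M] {ι : Type}
    {K : ι → Set M} {s : Finset ι} {i : ι} {V : Set M} {φ : ℂ × Circle → M}
    (h : IsTubularChart φ V (K i) (⋃ k ∈ {k | k ∈ s ∧ k ≠ i}, K k)) :
    Set.range φ \ K i ⊆ (⋃ k ∈ s, K k)ᶜ := by
  rintro _ ⟨⟨p, rfl⟩, hpK⟩ hpL
  obtain ⟨k, hk, hxk⟩ := Set.mem_iUnion₂.mp hpL
  exact h.notMem p (Set.mem_biUnion (show k ∈ {k | k ∈ s ∧ k ≠ i} from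
    ⟨hk, fun hki => hpK (hki ▸ hxk)⟩) hxk)

end

/-! ### Components of the preimage of a knot, and the Galois action on them -/

noncomputable section

section PreimageKnot

variable {M N : Type} [TopologicalSpace N] {ι : Type} {f : N → M} {K V : ι → Set M}

theorem preimageKnot_nonempty (j : PreimageIndex f K) : (preimageKnot f K j).Nonempty := by
  obtain ⟨i, c⟩ := j
  obtain ⟨x, rfl⟩ := ConnectedComponents.surjective_coe c
  exact ⟨x.1, x.2, rfl⟩

theorem preimageKnot_eq_image {j : PreimageIndex f K} (x : f ⁻¹' K j.1)
    (hx : ConnectedComponents.mk x = j.2) :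
    preimageKnot f K j = Subtype.val '' connectedComponent x := by
  ext y
  constructor
  · rintro ⟨hy, hyj⟩
    exact ⟨⟨y, hy⟩, ConnectedComponents.coe_eq_coe'.mp (hyj.trans hx.symm), rfl⟩
  · rintro ⟨y, hy, rfl⟩
    exact ⟨y.2, (ConnectedComponents.coe_eq_coe'.mpr hy).trans hx⟩

theorem isPreconnected_preimageKnot (j : PreimageIndex f K) :
    IsPreconnected (preimageKnot f K j) := by
  obtain ⟨x, hx, hxj⟩ := preimageKnot_nonempty j
  rw [preimageKnot_eq_image ⟨x, hx⟩ hxj]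
  exact isPreconnected_connectedComponent.image _ continuous_subtype_val.continuousOn

theorem preimageKnot_subset (j : PreimageIndex f K) : preimageKnot f K j ⊆ f ⁻¹' K j.1 :=
  fun _ hx => hx.1

theorem preimageNbhd_eq (hKV : ∀ i, K i ⊆ V i) {j : PreimageIndex f K} {x : N}
    (hx : x ∈ preimageKnot f K j) :
    preimageNbhd f K V j = connectedComponentIn (f ⁻¹' V j.1) x := by
  have hsub : preimageKnot f K j ⊆ f ⁻¹' V j.1 :=
    (preimageKnot_subset j).trans (Set.preimage_mono (hKV j.1))
  ext y
  constructor
  · rintro ⟨x', hx', hy⟩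
    rwa [connectedComponentIn_eq ((isPreconnected_preimageKnot j).subset_connectedComponentIn
      hx' hsub hx)] at hy
  · exact fun hy => ⟨x, hx, hy⟩

end PreimageKnot

section Transitivity

variable {M N : Type} [TopologicalSpace M] [TopologicalSpace N] {f : N → M}

/-- For an open map with finite automorphism group, transitivity on fibres over the complement of `L`
extends to the points that are limits of such fibres. -/
theorem exists_deckGroup_apply_eq [T2Space N] [Finite (deckGroup f)] (hf : Continuous f)
    (hfo : IsOpenMap f) {L : Set M} (hGal : IsGaloisOver f L) {x y : N} (hxy : f x = f y)
    (hx : x ∈ closure (f ⁻¹' Lᶜ)) : ∃ g : deckGroup f, (g : N ≃ₜ N) x = y := by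
  by_contra! hne
  -- separate `y` from all `g x`
  have hsep : ∀ g : deckGroup f, ∃ A B : Set N, IsOpen A ∧ IsOpen B ∧ x ∈ A ∧ y ∈ B ∧
      ∀ a ∈ A, (g : N ≃ₜ N) a ∉ B := by
    intro g
    obtain ⟨A, B, hA, hB, hxA, hyB, hAB⟩ := t2_separation (hne g)
    exact ⟨(g : N ≃ₜ N) ⁻¹' A, B, hA.preimage (g : N ≃ₜ N).continuous, hB, hxA, hyB,
      fun a ha hb => Set.disjoint_left.mp hAB ha hb⟩
  choose A B hA hB hxA hyB hAB using hsep
  have hBo : IsOpen (f '' ⋂ g, B g) := hfo _ (isOpen_iInter_of_finite hB)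
  have hO : IsOpen ((⋂ g, A g) ∩ f ⁻¹' (f '' ⋂ g, B g)) :=
    (isOpen_iInter_of_finite hA).inter (hBo.preimage hf)
  obtain ⟨x', ⟨hx'A, y', hy'B, hy'⟩, hx'L⟩ := mem_closure_iff.mp hx _ hO
    ⟨Set.mem_iInter.mpr hxA, y, Set.mem_iInter.mpr hyB, hxy.symm⟩
  obtain ⟨g, hg, hgx⟩ := hGal x' y' hy'.symm hx'L
  refine hAB ⟨g, hg⟩ x' (Set.mem_iInter.mp hx'A _) ?_
  change g x' ∈ _
  rw [hgx]
  exact Set.mem_iInter.mp hy'B _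

/-- An open map takes each component of the preimage of a connected closed set onto that set, if there
are only finitely many components. -/
theorem image_preimageKnot [T2Space M] [CompactSpace N] {ι : Type} {K : ι → Set M}
    (hf : Continuous f) (hfo : IsOpenMap f) (j : PreimageIndex f K) (hK : IsPreconnected (K j.1))
    (hKc : IsClosed (K j.1)) [Finite (ConnectedComponents (f ⁻¹' K j.1))] :
    f '' preimageKnot f K j = K j.1 := by
  obtain ⟨x, hx, hxj⟩ := preimageKnot_nonempty j
  have hJ := preimageKnot_eq_image ⟨x, hx⟩ hxj
  have : CompactSpace (f ⁻¹' K j.1) :=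
    isCompact_iff_compactSpace.mp (hKc.preimage hf).isCompact
  let r : f ⁻¹' K j.1 → K j.1 := (K j.1).restrictPreimage f
  have hr : IsOpenMap r := hfo.restrictPreimage _
  have hrc : Continuous r := hf.restrictPreimage
  have hop : IsOpen (connectedComponent (⟨x, hx⟩ : f ⁻¹' K j.1)) := by
    rw [← connectedComponents_preimage_singleton]
    exact (isOpen_discrete _).preimage ConnectedComponents.continuous_coe
  have hcl : IsClopen (r '' connectedComponent (⟨x, hx⟩ : f ⁻¹' K j.1)) :=
    ⟨(isClosed_connectedComponent.isCompact.image hrc).isClosed, hr _ hop⟩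
  have : PreconnectedSpace (K j.1) := isPreconnected_iff_preconnectedSpace.mp hK
  have huniv := hcl.eq_univ ⟨r ⟨x, hx⟩, _, mem_connectedComponent, rfl⟩
  rw [hJ, Set.image_image]
  ext m
  constructor
  · rintro ⟨y, -, rfl⟩
    exact y.2
  · intro hm
    obtain ⟨y, hy, hym⟩ : (⟨m, hm⟩ : K j.1) ∈ r '' _ := huniv ▸ Set.mem_univ _
    exact ⟨y, hy, congrArg Subtype.val hym⟩

end Transitivity

/-- A function with values in an abelian group and vanishing sum on a finite set with a transitive
cyclic permutation is a coboundary. -/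
theorem exists_eq_sub_of_sum_eq_zero {S A : Type} [Fintype S] [AddCommGroup A] (τ : Equiv.Perm S)
    (hτ : ∀ x y, ∃ k : ℤ, (τ ^ k) x = y) (α : S → A) (hα : ∑ x, α x = 0) :
    ∃ β : S → A, ∀ x, α x = β (τ.symm x) - β x := by
  classical
  rcases isEmpty_or_nonempty S with hS | ⟨⟨x₀⟩⟩
  · exact ⟨0, fun x => isEmptyElim x⟩
  let T : (S → A) →+ (S → A) :=
    { toFun := fun β x => β (τ.symm x) - β x
      map_zero' := by ext; simp
      map_add' := fun a b => by ext; simp only [Pi.add_apply]; abel }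
  suffices h : α ∈ T.range by
    obtain ⟨β, hβ⟩ := h
    exact ⟨β, fun x => (congrFun hβ x).symm⟩
  -- modulo coboundaries, a function may be moved from one point to any other
  have h1 : ∀ x a, Pi.single (τ x) a - Pi.single x a ∈ T.range := by
    intro x a
    refine ⟨Pi.single x a, funext fun y => ?_⟩
    have : (Pi.single x a : S → A) (τ.symm y) = (Pi.single (τ x) a : S → A) y := by
      simp only [Pi.single_apply, Equiv.symm_apply_eq]
    change (Pi.single x a : S → A) (τ.symm y) - _ = _
    rw [this]
    rfl
  have h2 : ∀ (k : ℤ) x a, Pi.single ((τ ^ k) x) a - Pi.single x a ∈ T.range := by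
    intro k x a
    induction k using Int.induction_on with
    | zero => simp
    | succ k ih =>
      have := T.range.add_mem (h1 ((τ ^ (k : ℤ)) x) a) ih
      rwa [sub_add_sub_cancel, ← Equiv.Perm.mul_apply, ← zpow_one_add, add_comm] at this
    | pred k ih =>
      have := T.range.sub_mem ih (h1 ((τ ^ (-(k : ℤ) - 1)) x) a)
      rwa [← Equiv.Perm.mul_apply, ← zpow_one_add, add_sub_cancel, sub_sub_sub_cancel_left] at this
  have h3 : α = ∑ x, (Pi.single x (α x) - Pi.single x₀ (α x)) := by
    rw [Finset.sum_sub_distrib, Finset.univ_sum_single]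
    have : ∑ x, (Pi.single x₀ (α x) : S → A) = Pi.single x₀ (∑ x, α x) :=
      (map_sum (AddMonoidHom.single (fun _ : S => A) x₀) α Finset.univ).symm
    rw [this, hα, Pi.single_zero, sub_zero]
  rw [h3]
  refine T.range.sum_mem fun x _ => ?_
  obtain ⟨k, hk⟩ := hτ x₀ x
  have := h2 k x₀ (α x)
  rwa [hk] at this

end

/-! ### Tate cohomology of cyclic groups and the idèles over a single knot -/

noncomputable section
open CategoryTheory

/-- For a finite cyclic group with generator `τ`, the first Tate cohomology group vanishes if every
element of norm zero is of the form `τ b - b`. -/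
theorem subsingleton_tateCohomology_one_of_norm {k G : Type} [CommRing k] [Group G] [Fintype G]
    (A : Rep k G) (τ : G) (hτ : ∀ g : G, g ∈ Subgroup.zpowers τ)
    (h : ∀ a : A, ∑ g, A.ρ g a = 0 → ∃ b, a = A.ρ τ b - b) :
    Subsingleton (tateCohomology A 1) := by
  let _ : CommGroup G := { (inferInstance : Group G) with
    mul_comm := fun a b => by
      obtain ⟨m, rfl⟩ := Subgroup.mem_zpowers_iff.mp (hτ a)
      obtain ⟨n, rfl⟩ := Subgroup.mem_zpowers_iff.mp (hτ b)
      rw [← zpow_add, ← zpow_add, add_comm] }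
  have hex : (Rep.FiniteCyclicGroup.subCompNormHom A τ).Exact := by
    refine (ShortComplex.moduleCat_exact_iff _).mpr fun a ha => ?_
    obtain ⟨b, hb⟩ := h a (by
      have h1 : A.ρ.norm a = 0 := ha
      rwa [Representation.norm, LinearMap.sum_apply] at h1)
    refine ⟨b, ?_⟩
    rw [hb]
    simp [Rep.sub_hom]
  exact ModuleCat.subsingleton_of_isZero (((ShortComplex.exact_iff_isZero_homology _).mp hex).of_iso
    ((TateCohomology.isoGroupCohomology 1).app A ≪≫
      Rep.FiniteCyclicGroup.groupCohomologyIsoOdd A τ hτ 1 odd_one))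

section Action

variable {M N : Type} [TopologicalSpace N] {ι : Type} {f : N → M}

/-- The permutation of the components of `f⁻¹(S)` given by an automorphism. -/
def deckPerm (f : N → M) (S : Set M) :
    deckGroup f →* Equiv.Perm (ConnectedComponents (f ⁻¹' S)) where
  toFun g :=
    { toFun := deckComp g
      invFun := deckComp g⁻¹
      left_inv := fun c => by rw [← deckComp_mul, inv_mul_cancel, deckComp_one]
      right_inv := fun c => by rw [← deckComp_mul, mul_inv_cancel, deckComp_one] }
  map_one' := Equiv.ext deckComp_one
  map_mul' g h := Equiv.ext (deckComp_mul g h)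

variable [TopologicalSpace M] [LocallyConnectedSpace N]

/-- The map `H₁(∂V_J) → H₁(∂V_K)` for a component `J` of `f⁻¹(K)`. -/
def boundaryPush (hf : Continuous f) (K V : ι → Set M) (i : ι)
    (c : ConnectedComponents (f ⁻¹' K i)) : H1 (frontier (preimageNbhd f K V ⟨i, c⟩)) →+ H1 (frontier (V i)) :=
  H1.mapOn hf (mapsTo_frontier_preimageNbhd hf K V ⟨i, c⟩)

/-- The maps to `H₁(∂V_K)` are compatible with the action of the Galois group. -/
theorem boundaryPush_mapOn (hf : Continuous f) (K V : ι → Set M) {i : ι}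
    {c c' : ConnectedComponents (f ⁻¹' K i)} (g : deckGroup f)
    (h : deckIndex g ⟨i, c⟩ = (⟨i, c'⟩ : PreimageIndex f K))
    (z : H1 (frontier (preimageNbhd f K V ⟨i, c⟩))) :
    boundaryPush hf K V i c' (H1.mapOn (g : N ≃ₜ N).continuous (deck_mapsTo_frontier V g h) z) =
      boundaryPush hf K V i c z := by
  simp only [boundaryPush, H1.mapOn, H1.map_map]
  congr 2
  ext x
  exact g.2 x

theorem boundaryPush_deckFamily (hf : Continuous f) (K V : ι → Set M) (g : deckGroup f)
    (a : ∀ j : PreimageIndex f K, H1 (frontier (preimageNbhd f K V j))) (i : ι)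
    (c : ConnectedComponents (f ⁻¹' K i)) :
    boundaryPush hf K V i c (deckFamily V g a ⟨i, c⟩) =
      boundaryPush hf K V i (deckComp g⁻¹ c) (a ⟨i, deckComp g⁻¹ c⟩) :=
  boundaryPush_mapOn hf K V g (deckIndex_inv_cancel g ⟨i, c⟩) _

/-- If the automorphism group acts transitively on the components over `K i`, all the groups
`H₁(∂V_J)` have the same image in `H₁(∂V_K)`, and so have the meridian subgroups. -/
theorem map_boundaryPush_eq (hf : Continuous f) (K V : ι → Set M) {i : ι}
    (htr : ∀ c c' : ConnectedComponents (f ⁻¹' K i), ∃ g : deckGroup f, deckComp g c = c')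
    (m : ∀ c, AddSubgroup (H1 (frontier (preimageNbhd f K V ⟨i, c⟩))))
    (hm : (∀ c, m c = ⊤) ∨ ∀ c, m c = meridianSubgroup (preimageNbhd f K V ⟨i, c⟩))
    (c c' : ConnectedComponents (f ⁻¹' K i)) :
    (m c).map (boundaryPush hf K V i c) = (m c').map (boundaryPush hf K V i c') := by
  have key : ∀ c c', (m c).map (boundaryPush hf K V i c) ≤
      (m c').map (boundaryPush hf K V i c') := by
    rintro c c' _ ⟨z, hz, rfl⟩
    obtain ⟨g, rfl⟩ := htr c c'
    have hg : deckIndex g ⟨i, c⟩ = (⟨i, deckComp g c⟩ : PreimageIndex f K) := rfl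
    rw [← boundaryPush_mapOn hf K V g hg z]
    refine AddSubgroup.mem_map_of_mem _ ?_
    rcases hm with hm | hm
    · rw [hm]
      exact AddSubgroup.mem_top _
    · rw [hm] at hz ⊢
      exact mapOn_mem_meridianSubgroup _ _ (deck_mapsTo_closure V g hg) hz
  exact le_antisymm (key c c') (key c' c)

/-- The vanishing statement for the part of the idèle group over a single component `K i`. -/
theorem exists_boundaryPush_eq_sub (hf : Continuous f) (K V : ι → Set M) {i : ι}
    [Finite (ConnectedComponents (f ⁻¹' K i))] (τ : deckGroup f)
    (hτ : ∀ g : deckGroup f, g ∈ Subgroup.zpowers τ)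
    (htr : ∀ c c' : ConnectedComponents (f ⁻¹' K i), ∃ g : deckGroup f, deckComp g c = c')
    (a : ∀ c, H1 (frontier (preimageNbhd f K V ⟨i, c⟩)))
    (ha : ∑ᶠ c, boundaryPush hf K V i c (a c) = 0) :
    ∃ b : ∀ c, H1 (frontier (preimageNbhd f K V ⟨i, c⟩)),
      (∀ c, boundaryPush hf K V i c (a c) =
        boundaryPush hf K V i (deckComp τ⁻¹ c) (b (deckComp τ⁻¹ c)) -
          boundaryPush hf K V i c (b c)) ∧
      ((∀ c, a c ∈ meridianSubgroup (preimageNbhd f K V ⟨i, c⟩)) →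
        ∀ c, b c ∈ meridianSubgroup (preimageNbhd f K V ⟨i, c⟩)) := by
  classical
  have := Fintype.ofFinite (ConnectedComponents (f ⁻¹' K i))
  obtain ⟨m, hm, ham, hmer⟩ : ∃ m : ∀ c, AddSubgroup (H1 (frontier (preimageNbhd f K V ⟨i, c⟩))),
      ((∀ c, m c = ⊤) ∨ ∀ c, m c = meridianSubgroup (preimageNbhd f K V ⟨i, c⟩)) ∧
      (∀ c, a c ∈ m c) ∧
      ((∀ c, a c ∈ meridianSubgroup (preimageNbhd f K V ⟨i, c⟩)) →
        ∀ c, m c = meridianSubgroup (preimageNbhd f K V ⟨i, c⟩)) := by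
    by_cases h : ∀ c, a c ∈ meridianSubgroup (preimageNbhd f K V ⟨i, c⟩)
    · exact ⟨_, Or.inr fun c => rfl, h, fun _ c => rfl⟩
    · exact ⟨fun _ => ⊤, Or.inl fun c => rfl, fun c => trivial, fun h' => absurd h' h⟩
  -- the common image of the groups `m c`
  let B : AddSubgroup (H1 (frontier (V i))) := ⨆ c, (m c).map (boundaryPush hf K V i c)
  have hB : ∀ c, B = (m c).map (boundaryPush hf K V i c) := fun c =>
    le_antisymm (iSup_le fun c' => (map_boundaryPush_eq hf K V htr m hm c' c).le)
      (le_iSup (fun c => (m c).map (boundaryPush hf K V i c)) c)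
  let α : ConnectedComponents (f ⁻¹' K i) → B := fun c =>
    ⟨boundaryPush hf K V i c (a c), hB c ▸ AddSubgroup.mem_map_of_mem _ (ham c)⟩
  have hα : ∑ c, α c = 0 := by
    refine Subtype.ext ?_
    rw [AddSubgroup.val_finsetSum, ← finsum_eq_sum_of_fintype]
    exact ha
  obtain ⟨β, hβ⟩ := exists_eq_sub_of_sum_eq_zero (deckPerm f (K i) τ) (fun c c' => by
    obtain ⟨g, hg⟩ := htr c c'
    obtain ⟨k, rfl⟩ := Subgroup.mem_zpowers_iff.mp (hτ g)
    exact ⟨k, by rw [← map_zpow]; exact hg⟩) α hα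
  have hβm : ∀ c, ∃ z ∈ m c, boundaryPush hf K V i c z = β c := fun c =>
    AddSubgroup.mem_map.mp (hB c ▸ (β c).2)
  choose b hbm hb using hβm
  refine ⟨b, fun c => ?_, fun h c => hmer h c ▸ hbm c⟩
  rw [hb, hb]
  exact congrArg Subtype.val (hβ c)

end Action

end

/-! ### Vanishing for the whole idèle group -/

section BranchedCover

variable {M : Type} [TopologicalSpace M] [T2Space M] {ι : Type} {K V : ι → Set M}
  {N : Type} [TopologicalSpace N] {s : Finset ι} {f : N → M}

/-- The tubular neighbourhood of a component of the link has a chart that avoids the other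
components of the branch locus. -/
theorem IsTameLink.exists_isTubularChart (hK : IsTameLink K)
    (hV : ∀ i, IsTubularNeighborhood (V i) (K i))
    (hVs : ∀ i, ∀ k ∈ s, k ≠ i → Disjoint (V i) (K k)) (i : ι) :
    ∃ φ, IsTubularChart φ (V i) (K i) (⋃ k ∈ {k | k ∈ s ∧ k ≠ i}, K k) := by
  refine (hV i).exists_isTubularChart ?_ ?_
  · exact Set.Finite.isClosed_biUnion (s.finite_toSet.subset fun k hk => hk.1) fun k _ =>
      (hK.tame k).isCompact.isClosed
  · exact Set.disjoint_iUnion₂_right.mpr fun k hk => hVs i k hk.1 hk.2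

/-- The Galois group acts transitively on the components of the preimage of a knot. -/
theorem IsBranchedCover.exists_deckComp_eq [T2Space N] [CompactSpace N] (hK : IsTameLink K)
    (hf : IsBranchedCover f (⋃ k ∈ s, K k)) (hGal : IsGaloisOver f (⋃ k ∈ s, K k))
    [Finite (deckGroup f)] {i : ι} {φ : ℂ × Circle → M}
    (h : IsTubularChart φ (V i) (K i) (⋃ k ∈ {k | k ∈ s ∧ k ≠ i}, K k))
    (c c' : ConnectedComponents (f ⁻¹' K i)) : ∃ g : deckGroup f, deckComp g c = c' := by
  have := hf.finite_components hK i
  have hKi : IsPreconnected (K i) := by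
    rw [← h.image_core]
    exact (isPreconnected_singleton.prod isPreconnected_univ).image _
      h.isOpenEmbedding.continuous.continuousOn
  obtain ⟨x, hx, hxc⟩ := preimageKnot_nonempty (⟨i, c⟩ : PreimageIndex f K)
  change f x ∈ K i at hx
  change ConnectedComponents.mk (⟨x, hx⟩ : f ⁻¹' K i) = c at hxc
  obtain ⟨y, ⟨hy, hyc⟩, hyx⟩ : f x ∈ f '' preimageKnot f K ⟨i, c'⟩ := by
    rw [image_preimageKnot hf.continuous hf.isOpenMap ⟨i, c'⟩ hKi h.isCompact_core.isClosed]
    exact hx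
  change f y ∈ K i at hy
  change ConnectedComponents.mk (⟨y, hy⟩ : f ⁻¹' K i) = c' at hyc
  have hcl : x ∈ closure (f ⁻¹' (⋃ k ∈ s, K k)ᶜ) := by
    obtain ⟨O, -, hxO, hOφ, -, hOd⟩ := hf.exists_nhds_isPreconnected_diff hK.disjoint h hx
    refine closure_mono ?_ (hOd hxO)
    exact fun v hv => h.range_diff_subset_compl ⟨hOφ hv.1, hv.2⟩
  obtain ⟨g, hg⟩ := exists_deckGroup_apply_eq hf.continuous hf.isOpenMap hGal hyx.symm hcl
  refine ⟨g, ?_⟩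
  have h1 : deckComp g (ConnectedComponents.mk (⟨x, hx⟩ : f ⁻¹' K i)) =
      ConnectedComponents.mk (⟨(g : N ≃ₜ N) x, deckGroup_mapsTo g _ hx⟩ : f ⁻¹' K i) := rfl
  rw [← hxc, ← hyc, h1]
  exact congrArg ConnectedComponents.mk (Subtype.ext hg)

/-- The map `H₁(∂V_J) → H₁(∂V_K)` is injective, with torsion-free image: the cases `n = 1` and
general `n`. -/
theorem IsBranchedCover.eq_zero_of_zsmul_boundaryPush_eq_zero [LocallyPathConnectedSpace N]
    (hK : IsTameLink K) (hV : ∀ i, IsTubularNeighborhood (V i) (K i))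
    (hf : IsBranchedCover f (⋃ k ∈ s, K k)) {i : ι} {φ : ℂ × Circle → M}
    (h : IsTubularChart φ (V i) (K i) (⋃ k ∈ {k | k ∈ s ∧ k ≠ i}, K k))
    (c : ConnectedComponents (f ⁻¹' K i)) {n : ℤ} (hn : n ≠ 0)
    {z : H1 (frontier (preimageNbhd f K V ⟨i, c⟩))}
    (hz : n • boundaryPush hf.continuous K V i c z = 0) : z = 0 := by
  obtain ⟨x, hx⟩ := preimageKnot_nonempty (⟨i, c⟩ : PreimageIndex f K)
  have hD : preimageNbhd f K V ⟨i, c⟩ = connectedComponentIn (f ⁻¹' V i) x := by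
    refine preimageNbhd_eq (fun k => ?_) hx
    obtain ⟨ψ, -, hψK, hψV⟩ := hV k
    rw [← hψK, ← hψV]
    exact Set.image_mono (Set.prod_mono_left (by simp))
  have key : ∀ (D : Set N) (hmap : Set.MapsTo f (frontier D) (frontier (V i)))
      (z : H1 (frontier D)), D = connectedComponentIn (f ⁻¹' V i) x →
      n • H1.mapOn hf.continuous hmap z = 0 → z = 0 := by
    rintro D hmap z rfl hz
    exact h.eq_zero_of_zsmul_mapOn_eq_zero hf.continuous
      (hf.covering.mono h.range_diff_subset_compl)
      (fun y hy => hf.exists_nhds_isPreconnected_diff hK.disjoint h hy) x hmap hn hz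
  exact key _ _ z hD hz

end BranchedCover

theorem theorem3p1
    -- an oriented connected closed 3-manifold with a very admissible link
    {M : Type} [TopologicalSpace M] [T2Space M] [CompactSpace M] [ConnectedSpace M]
    [ChartedSpace (EuclideanSpace ℝ (Fin 3)) M] (o : Orientation3 M)
    {ι : Type} (K : ι → Set M) (hK : IsVeryAdmissible K)
    -- a tubular neighbourhood of each component
    (V : ι → Set M) (hV : ∀ i, IsTubularNeighborhood (V i) (K i))
    -- a finite cyclic cover branched over the finite sublink with components `K i`, `i ∈ s`
    {N : Type} [TopologicalSpace N] [T2Space N] [CompactSpace N] [ConnectedSpace N]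
    [ChartedSpace (EuclideanSpace ℝ (Fin 3)) N]
    (s : Finset ι) (f : N → M) (hf : IsBranchedCover f (⋃ i ∈ s, K i))
    (hGal : IsGaloisOver f (⋃ i ∈ s, K i)) [Fintype (deckGroup f)]
    (τ : deckGroup f) (hτ : ∀ g : deckGroup f, g ∈ Subgroup.zpowers τ)
    -- the tubular neighbourhoods avoid the other components of the branch link
    (hVs : ∀ i, ∀ k ∈ s, k ≠ i → Disjoint (V i) (K k)) :
    Subsingleton (tateCohomology (Rep.of (ideleRep f K V)) 1) ∧
    ∀ a : ideleGroup (preimageNbhd f K V), branchedPush hK.link hf V a = 0 →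
      ∃ b : ideleGroup (preimageNbhd f K V), a = ideleRep f K V τ b - b := by
  have hlpc : LocallyPathConnectedSpace N :=
    ChartedSpace.locallyPathConnectedSpace (EuclideanSpace ℝ (Fin 3)) N
  have hlc : LocallyConnectedSpace N :=
    ChartedSpace.locallyConnectedSpace (EuclideanSpace ℝ (Fin 3)) N
  have hfin := hf.finite_components hK.link
  choose φ hφ using hK.link.exists_isTubularChart hV hVs
  have htr : ∀ i (c c' : ConnectedComponents (f ⁻¹' K i)), ∃ g : deckGroup f, deckComp g c = c' :=
    fun i => hf.exists_deckComp_eq hK.link hGal (hφ i)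
  have htf : ∀ i c {n : ℤ}, n ≠ 0 → ∀ {z : H1 (frontier (preimageNbhd f K V ⟨i, c⟩))},
      n • boundaryPush hf.continuous K V i c z = 0 → z = 0 := fun i c n hn z =>
    hf.eq_zero_of_zsmul_boundaryPush_eq_zero hK.link hV (hφ i) c hn
  have hpush : ∀ (a : ideleGroup (preimageNbhd f K V)) i, (branchedPush hK.link hf V a).1 i =
      ∑ᶠ c, boundaryPush hf.continuous K V i c (a.1 ⟨i, c⟩) := fun a i => rfl
  have hsnd : ∀ a : ideleGroup (preimageNbhd f K V), branchedPush hK.link hf V a = 0 →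
      ∃ b : ideleGroup (preimageNbhd f K V), a = ideleRep f K V τ b - b := by
    intro a ha
    have hex := fun i => exists_boundaryPush_eq_sub hf.continuous K V τ hτ (htr i)
      (fun c => a.1 ⟨i, c⟩) (by rw [← hpush, ha]; rfl)
    choose b hb hbm using hex
    have hmem : (fun j : PreimageIndex f K => b j.1 j.2) ∈ ideleGroup (preimageNbhd f K V) := by
      refine Set.Finite.subset (Set.Finite.preimage' (f := Sigma.fst) (a.2.image Sigma.fst)
        fun i _ => ?_) (fun j hj => ?_)
      · refine (Set.finite_range (Sigma.mk i)).subset ?_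
        rintro ⟨_, c⟩ rfl
        exact ⟨c, rfl⟩
      · by_contra hja
        refine hj (hbm j.1 (fun c => ?_) j.2)
        by_contra hc
        exact hja ⟨⟨j.1, c⟩, hc, rfl⟩
    refine ⟨⟨_, hmem⟩, Subtype.ext (funext fun ⟨i, c⟩ => ?_)⟩
    rw [← sub_eq_zero]
    refine htf i c one_ne_zero ?_
    have h1 : boundaryPush hf.continuous K V i c (a.1 ⟨i, c⟩) =
        boundaryPush hf.continuous K V i c
          (deckFamily V τ (fun j : PreimageIndex f K => b j.1 j.2) ⟨i, c⟩) -
            boundaryPush hf.continuous K V i c (b i c) := by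
      rw [boundaryPush_deckFamily]
      exact hb i c
    rw [one_smul, map_sub, sub_eq_zero, h1, ← map_sub]
    rfl
  refine ⟨subsingleton_tateCohomology_one_of_norm _ τ hτ fun a ha => hsnd a ?_, hsnd⟩
  -- the norm of `a` is pushed forward to the multiple of `f_* a` by the order of the group
  have hinv : ∀ (g : deckGroup f) (a : ideleGroup (preimageNbhd f K V)),
      branchedPush hK.link hf V (ideleRep f K V g a) = branchedPush hK.link hf V a := by
    intro g a
    refine Subtype.ext (funext fun i => ?_)
    rw [hpush, hpush]
    have h1 : ∀ c, boundaryPush hf.continuous K V i c ((ideleRep f K V g a).1 ⟨i, c⟩) =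
        boundaryPush hf.continuous K V i (deckPerm f (K i) g⁻¹ c)
          (a.1 ⟨i, deckPerm f (K i) g⁻¹ c⟩) := boundaryPush_deckFamily hf.continuous K V g a.1 i
    rw [finsum_congr h1]
    exact finsum_comp_equiv (deckPerm f (K i) g⁻¹)
      (f := fun c => boundaryPush hf.continuous K V i c (a.1 ⟨i, c⟩))
  have hcard : (Fintype.card (deckGroup f) : ℤ) • branchedPush hK.link hf V a = 0 := by
    have h1 : ∑ g : deckGroup f, ideleRep f K V g a = 0 := ha
    have h2 := congrArg (branchedPush hK.link hf V) h1
    rw [map_sum, map_zero] at h2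
    simp only [hinv] at h2
    rw [Finset.sum_const, Finset.card_univ] at h2
    rwa [natCast_zsmul]
  refine Subtype.ext (funext fun i => ?_)
  have hi : (Fintype.card (deckGroup f) : ℤ) • (branchedPush hK.link hf V a).1 i = 0 :=
    congrFun (congrArg Subtype.val hcard) i
  have := Fintype.ofFinite (ConnectedComponents (f ⁻¹' K i))
  rcases isEmpty_or_nonempty (ConnectedComponents (f ⁻¹' K i)) with hemp | ⟨⟨c₀⟩⟩
  · rw [hpush, finsum_of_isEmpty]
    rfl
  -- the component of `f_* a` at `K i` comes from a single boundary torus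
  obtain ⟨z, hz⟩ : (branchedPush hK.link hf V a).1 i ∈
      (boundaryPush hf.continuous K V i c₀).range := by
    rw [hpush, finsum_eq_sum_of_fintype]
    refine AddSubgroup.sum_mem _ fun c _ => ?_
    have h1 := map_boundaryPush_eq hf.continuous K V (htr i) (fun _ => ⊤) (Or.inl fun _ => rfl) c c₀
    rw [← AddMonoidHom.range_eq_map, ← AddMonoidHom.range_eq_map] at h1
    exact h1 ▸ ⟨_, rfl⟩
  have hcne : (Fintype.card (deckGroup f) : ℤ) ≠ 0 :=
    Int.natCast_ne_zero.mpr Fintype.card_ne_zero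
  rw [← hz] at hi ⊢
  rw [htf i c₀ hcne hi, map_zero]
  rfl
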